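/- Let $0\le k<n\le m$ be integers. Let $D$ be the left-justified diagram obtained from the rectangle with $m$ rows of length $n$ by deleting the staircase $\delta_k=(k,k-1,\dots,1)$ from its upper right corner, i.e. row $i$ of $D$ has $n-\max(k+1-i,0)$ boxes for $1\le i\le m$. A standard tableau of shape $D$ is a filling of the $mn-\binom{k+1}{2}$ boxes of $D$ with the integers $1,\dots,mn-\binom{k+1}{2}$, each used exactly once, that increases along rows and down columns. Then the number of standard tableaux of shape $D$ is $$\binom{mn-\binom{k+1}{2}}{m(n-k-1)}\, f_{(n-k-1)^m}\; g_{(m,m-1,\dots,m-k)}\;\frac{E_1(k+1,m,n-k-1)}{E_1(k+1,m,0)},$$ where $f_\lambda$ is the number of standard Young tableaux of straight shape $\lambda$ (with $(n-k-1)^m$ the partition with $m$ parts equal to $n-k-1$; $f=1$ for the empty shape), $g_\lambda$ is the number of standard Young tableaux of shifted shape $\lambda$ (row $i$ of the diagram starts in column $i$), and, for integers $0\le r\le p$ and $s\ge 0$, $$E_1(r,p,s)=\begin{cases}\displaystyle\prod_{r<l<2p-r+2}\frac{1}{(l+2s)^{r/2}}\;\prod_{2\le l\le r}\frac{1}{\big((l+2s)(2p-l+2+2s)\big)^{\lfloor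 l/2\rfloor}}, & r\text{ even},\\[2ex] \displaystyle\frac{\left(\frac{r-1}{2}+s\right)!}{\left(p-\frac{r-1}{2}+s\right)!}\,E_1(r-1,p,s), & r\text{ odd},\end{cases}$$ the products being over integers $l$. -/

import Mathlib

/-- The straight diagram of truncated shape `lam \ mu`: left justified rows, row `i` having
`lam i - mu i` boxes. Boxes are pairs (row, column), counted from `0`; a list entry that is absent
is `0`. For `mu = []` this is the ordinary diagram of `lam`. -/
def straightDiagram (lam mu : List ℕ) : Finset (ℕ × ℕ) :=
  (Finset.range lam.length).biUnion fun i =>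
    (Finset.range (lam.getD i 0 - mu.getD i 0)).image fun j => (i, j)

/-- The shifted diagram of truncated shape `lam \ mu`: as above, but row `i` starts in column `i`.
For `mu = []` this is the ordinary shifted diagram of `lam`. -/
def shiftedDiagram (lam mu : List ℕ) : Finset (ℕ × ℕ) :=
  (Finset.range lam.length).biUnion fun i =>
    (Finset.range (lam.getD i 0 - mu.getD i 0)).image fun j => (i, i + j)

/-- Standard tableaux on a finite set `D` of boxes: fillings of `D` with the integers `1, …, |D|`,
each used exactly once, that increase along rows and down columns. -/
structure StandardTableau (D : Finset (ℕ × ℕ)) where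
  entry : D ≃ Finset.Icc 1 D.card
  row_lt : ∀ a b : D, a.1.1 = b.1.1 → a.1.2 < b.1.2 → entry a < entry b
  col_lt : ∀ a b : D, a.1.2 = b.1.2 → a.1.1 < b.1.1 → entry a < entry b

/-- The number of standard tableaux on `D`. -/
noncomputable def numStandardTableaux (D : Finset (ℕ × ℕ)) : ℕ :=
  Nat.card (StandardTableau D)

/-- `f_lam`: the number of standard Young tableaux of straight shape `lam`. -/
noncomputable def numStraightSYT (lam : List ℕ) : ℕ :=
  numStandardTableaux (straightDiagram lam [])

/-- `g_lam`: the number of standard Young tableaux of shifted shape `lam`. -/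
noncomputable def numShiftedSYT (lam : List ℕ) : ℕ :=
  numStandardTableaux (shiftedDiagram lam [])

/-- The sequence `(a, a - 1, …, a - r + 1)` of length `r`, for `r ≤ a`. -/
def descendingList (a r : ℕ) : List ℕ :=
  (List.range r).map fun i => a - i

/-- The staircase partition `δ_k = (k, k - 1, …, 1)`. -/
def staircase (k : ℕ) : List ℕ := descendingList k k

/-- The product `E₁(r, p, s)` for even `r ≤ p`. -/
def E1Even (r p s : ℕ) : ℚ :=
  (∏ l ∈ Finset.Ioo r (2 * p + 2 - r), 1 / ((l : ℚ) + 2 * s) ^ (r / 2)) *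
    ∏ l ∈ Finset.Icc 2 r,
      1 / (((l : ℚ) + 2 * s) * (2 * (p : ℚ) - l + 2 + 2 * s)) ^ (l / 2)

/-- The product `E₁(r, p, s)` for `r ≤ p`; for odd `r` it is
`((r-1)/2 + s)! / (p - (r-1)/2 + s)! * E₁(r-1, p, s)`. -/
def E1 (r p s : ℕ) : ℚ :=
  if Even r then E1Even r p s
  else (((r - 1) / 2 + s).factorial : ℚ) / ((p - (r - 1) / 2 + s).factorial : ℚ) *
    E1Even (r - 1) p s

/-! Put `r = k + 1` and `d = n - r`. Cut by columns, the truncated rectangle has `d` columns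
starting in the top row, after which each starting row is given by the diagonal, as in a transposed
shifted shape. More generally, encode such a diagram by strictly decreasing numbers `x j`; the
rectangle has `x j = m + d - j`. Up to the factor `N! / ∏ (x j)!`, with `N` the number of boxes, the
number of tableaux is `tableauSum`: a signed sum over `r / 2`-element sets `J` of columns of
products of linear and pair factors.

This holds because both sides obey the recursion that removes the box of the largest entry. Partial
fractions show that each summand is an eigenvector of the operator `f ↦ ∑ x i * f (x - e i)`, with
an eigenvalue, equal to the number of boxes, that depends on `J` only through its cardinality
(`sum_mul_tableauTerm_update`). Boundary terms are right because the sum vanishes when adjacent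
arguments coincide (`tableauSum_eq_zero`) and loses its last column when that has height zero
(`tableauSum_succ`).

For an arithmetic progression `x j = u - j`, pulling out the Vandermonde product leaves a sum over
subsets with nodes `(x j) ^ 2`. Andréief's identity makes it a determinant
(`subsetSum_range_eq_det`) whose entries are divided differences over intervals of nodes. They have
closed forms: a row factor, a column factor and a central binomial or Catalan number. The remaining
Hankel determinant is a product up to a constant (`exists_det_hankel_eq`).

The constant is never computed. The count is `N! * C * rectangleFactor m d * E1 r m d` with `C`
independent of `d` (`exists_numStandardTableaux_eq`). For `d = 0` the shape is the transposed
shifted shape, which eliminates `C`; for `r = 0` it is the rectangle, with `C = 1`. -/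

/-! ### Tableaux as fillings, and removal of the largest entry -/

/-- `a` lies strictly before `b` in the same row or in the same column. -/
def BoxBefore (a b : ℕ × ℕ) : Prop :=
  (a.1 = b.1 ∧ a.2 < b.2) ∨ (a.2 = b.2 ∧ a.1 < b.1)

instance : DecidableRel BoxBefore := fun a b => by unfold BoxBefore; infer_instance

/-- Standard tableaux on `D`, as functions on all boxes that vanish off `D`. -/
def fillings (D : Finset (ℕ × ℕ)) : Set (ℕ × ℕ → ℕ) :=
  {f | (∀ p, p ∉ D → f p = 0) ∧ Set.BijOn f D (Finset.Icc 1 D.card) ∧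
    ∀ a ∈ D, ∀ b ∈ D, BoxBefore a b → f a < f b}

/-- The boxes of `D` that can carry the largest entry. -/
def maximalBoxes (D : Finset (ℕ × ℕ)) : Finset (ℕ × ℕ) :=
  D.filter fun c => ∀ b ∈ D, ¬ BoxBefore c b

theorem BoxBefore.ne {a b : ℕ × ℕ} (h : BoxBefore a b) : a ≠ b := by
  rintro rfl
  rcases h with h | h <;> exact absurd h.2 (lt_irrefl _)

/-- The filling of all boxes given by a tableau. -/
noncomputable def StandardTableau.toFilling {D : Finset (ℕ × ℕ)} (T : StandardTableau D)
    (p : ℕ × ℕ) : ℕ :=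
  if h : p ∈ D then (T.entry ⟨p, h⟩ : ℕ) else 0

theorem StandardTableau.toFilling_of_mem {D : Finset (ℕ × ℕ)} (T : StandardTableau D)
    {p : ℕ × ℕ} (h : p ∈ D) : T.toFilling p = (T.entry ⟨p, h⟩ : ℕ) := dif_pos h

theorem StandardTableau.toFilling_mem {D : Finset (ℕ × ℕ)} (T : StandardTableau D) :
    T.toFilling ∈ fillings D := by
  refine ⟨fun p hp => dif_neg hp, ⟨?_, ?_, ?_⟩, ?_⟩
  · intro p hp
    rw [T.toFilling_of_mem hp]
    exact (T.entry ⟨p, hp⟩).2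
  · intro p hp q hq h
    rw [T.toFilling_of_mem hp, T.toFilling_of_mem hq] at h
    have := T.entry.injective (Subtype.ext h)
    exact congrArg Subtype.val this
  · intro v hv
    refine ⟨(T.entry.symm ⟨v, hv⟩ : D).1, (T.entry.symm ⟨v, hv⟩).2, ?_⟩
    rw [T.toFilling_of_mem (T.entry.symm ⟨v, hv⟩).2]
    simp
  · intro a ha b hb h
    rw [T.toFilling_of_mem ha, T.toFilling_of_mem hb]
    rcases h with ⟨h1, h2⟩ | ⟨h1, h2⟩
    · exact T.row_lt ⟨a, ha⟩ ⟨b, hb⟩ h1 h2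
    · exact T.col_lt ⟨a, ha⟩ ⟨b, hb⟩ h1 h2

theorem StandardTableau.toFilling_injective {D : Finset (ℕ × ℕ)} :
    Function.Injective (StandardTableau.toFilling (D := D)) := by
  rintro ⟨e, h1, h2⟩ ⟨e', h1', h2'⟩ h
  have : e = e' := by
    ext ⟨p, hp⟩
    have := congrFun h p
    rwa [StandardTableau.toFilling_of_mem _ hp, StandardTableau.toFilling_of_mem _ hp] at this
  subst this
  rfl

theorem StandardTableau.exists_toFilling_eq {D : Finset (ℕ × ℕ)} {f : ℕ × ℕ → ℕ}
    (hf : f ∈ fillings D) : ∃ T : StandardTableau D, T.toFilling = f := by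
  obtain ⟨h0, hb, hm⟩ := hf
  let e : D ≃ Finset.Icc 1 D.card := Equiv.ofBijective
    (fun p => ⟨f p.1, hb.mapsTo p.2⟩)
    ⟨fun p q h => Subtype.ext (hb.injOn p.2 q.2 (congrArg Subtype.val h)), fun v => by
      obtain ⟨p, hp, hpv⟩ := hb.surjOn v.2
      exact ⟨⟨p, hp⟩, Subtype.ext hpv⟩⟩
  refine ⟨⟨e, fun a b h1 h2 => hm _ a.2 _ b.2 (Or.inl ⟨h1, h2⟩),
    fun a b h1 h2 => hm _ a.2 _ b.2 (Or.inr ⟨h1, h2⟩)⟩, ?_⟩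
  funext p
  by_cases hp : p ∈ D
  · rw [StandardTableau.toFilling_of_mem _ hp]
    rfl
  · rw [h0 p hp]
    exact dif_neg hp

instance (D : Finset (ℕ × ℕ)) : Finite (StandardTableau D) :=
  Finite.of_injective (fun T => T.entry) (by
    rintro ⟨e, h1, h2⟩ ⟨e', h1', h2'⟩ h
    dsimp at h
    subst h
    rfl)

/-- Standard tableaux are the same as fillings. -/
noncomputable def standardTableauEquiv (D : Finset (ℕ × ℕ)) : StandardTableau D ≃ fillings D :=
  Equiv.ofBijective (fun T => ⟨T.toFilling, T.toFilling_mem⟩)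
    ⟨fun _ _ h => StandardTableau.toFilling_injective (congrArg Subtype.val h), fun f => by
      obtain ⟨T, hT⟩ := StandardTableau.exists_toFilling_eq f.2
      exact ⟨T, Subtype.ext hT⟩⟩

instance (D : Finset (ℕ × ℕ)) : Finite (fillings D) :=
  Finite.of_equiv _ (standardTableauEquiv D)

theorem numStandardTableaux_eq_card (D : Finset (ℕ × ℕ)) :
    numStandardTableaux D = Nat.card (fillings D) :=
  Nat.card_congr (standardTableauEquiv D)

theorem update_mem_fillings {D : Finset (ℕ × ℕ)} {c : ℕ × ℕ} (hc : c ∈ maximalBoxes D)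
    {f : ℕ × ℕ → ℕ} (hf : f ∈ fillings (D.erase c)) :
    Function.update f c D.card ∈ fillings D := by
  obtain ⟨hcD, hmax⟩ := Finset.mem_filter.1 hc
  obtain ⟨h0, hb, hm⟩ := hf
  have hcard : (D.erase c).card + 1 = D.card := Finset.card_erase_add_one hcD
  have hval : ∀ p ∈ D, p ≠ c → 1 ≤ f p ∧ f p < D.card := by
    intro p hp hpc
    have := hb.mapsTo (Finset.mem_coe.2 (Finset.mem_erase.2 ⟨hpc, hp⟩))
    rw [Finset.mem_coe, Finset.mem_Icc] at this
    omega
  refine ⟨?_, ⟨?_, ?_, ?_⟩, ?_⟩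
  · intro p hp
    have hpc : p ≠ c := fun h => hp (h ▸ hcD)
    rw [Function.update_of_ne hpc]
    exact h0 p fun h => hp (Finset.mem_of_mem_erase h)
  · intro p hp
    rw [Finset.mem_coe, Finset.mem_Icc]
    by_cases hpc : p = c
    · subst hpc
      simp only [Function.update_self]
      omega
    · rw [Function.update_of_ne hpc]
      have := hval p hp hpc
      omega
  · intro p hp q hq h
    by_cases hpc : p = c <;> by_cases hqc : q = c
    · rw [hpc, hqc]
    · subst hpc
      rw [Function.update_self, Function.update_of_ne hqc] at h
      have := hval q hq hqc
      omega
    · subst hqc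
      rw [Function.update_self, Function.update_of_ne hpc] at h
      have := hval p hp hpc
      omega
    · rw [Function.update_of_ne hpc, Function.update_of_ne hqc] at h
      exact hb.injOn (Finset.mem_coe.2 (Finset.mem_erase.2 ⟨hpc, hp⟩))
        (Finset.mem_coe.2 (Finset.mem_erase.2 ⟨hqc, hq⟩)) h
  · intro v hv
    rw [Finset.mem_coe, Finset.mem_Icc] at hv
    by_cases hvN : v = D.card
    · exact ⟨c, hcD, by rw [Function.update_self, hvN]⟩
    · obtain ⟨p, hp, hpv⟩ := hb.surjOn (show v ∈ ((Finset.Icc 1 (D.erase c).card : Finset ℕ) : Set ℕ) by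
        rw [Finset.mem_coe, Finset.mem_Icc]; omega)
      obtain ⟨hpc, hpD⟩ := Finset.mem_erase.1 (Finset.mem_coe.1 hp)
      exact ⟨p, hpD, by rw [Function.update_of_ne hpc, hpv]⟩
  · intro a ha b hb' hab
    have hac : a ≠ c := fun h => hmax b hb' (h ▸ hab)
    rw [Function.update_of_ne hac]
    by_cases hbc : b = c
    · subst hbc
      rw [Function.update_self]
      exact (hval a ha hac).2
    · rw [Function.update_of_ne hbc]
      exact hm a (Finset.mem_erase.2 ⟨hac, ha⟩) b (Finset.mem_erase.2 ⟨hbc, hb'⟩) hab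

theorem exists_update_eq {D : Finset (ℕ × ℕ)} (hD : D.Nonempty) {f : ℕ × ℕ → ℕ}
    (hf : f ∈ fillings D) :
    ∃ c ∈ maximalBoxes D, ∃ g ∈ fillings (D.erase c), Function.update g c D.card = f := by
  obtain ⟨h0, hb, hm⟩ := hf
  have hpos : 1 ≤ D.card := Finset.card_pos.2 hD
  obtain ⟨c, hcD, hc⟩ := hb.surjOn (show D.card ∈ ((Finset.Icc 1 D.card : Finset ℕ) : Set ℕ) by
    rw [Finset.mem_coe, Finset.mem_Icc]; omega)
  have hcD : c ∈ D := hcD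
  have hcard : (D.erase c).card + 1 = D.card := Finset.card_erase_add_one hcD
  have hval : ∀ p ∈ D, 1 ≤ f p ∧ f p ≤ D.card := fun p hp => by
    simpa using hb.mapsTo (Finset.mem_coe.2 hp)
  refine ⟨c, Finset.mem_filter.2 ⟨hcD, fun b hb' hcb => ?_⟩, Function.update f c 0,
    ⟨?_, ⟨?_, ?_, ?_⟩, ?_⟩, ?_⟩
  · have := hm c hcD b hb' hcb
    have := (hval b hb').2
    omega
  · intro p hp
    by_cases hpc : p = c
    · rw [hpc, Function.update_self]
    · rw [Function.update_of_ne hpc]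
      exact h0 p fun h => hp (Finset.mem_erase.2 ⟨hpc, h⟩)
  · intro p hp
    obtain ⟨hpc, hpD⟩ := Finset.mem_erase.1 (Finset.mem_coe.1 hp)
    rw [Function.update_of_ne hpc, Finset.mem_coe, Finset.mem_Icc]
    have h1 := hval p hpD
    have h2 : f p ≠ D.card := fun h => hpc (hb.injOn hpD hcD (h.trans hc.symm))
    omega
  · intro p hp q hq h
    obtain ⟨hpc, hpD⟩ := Finset.mem_erase.1 (Finset.mem_coe.1 hp)
    obtain ⟨hqc, hqD⟩ := Finset.mem_erase.1 (Finset.mem_coe.1 hq)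
    rw [Function.update_of_ne hpc, Function.update_of_ne hqc] at h
    exact hb.injOn hpD hqD h
  · intro v hv
    rw [Finset.mem_coe, Finset.mem_Icc] at hv
    obtain ⟨p, hp, hpv⟩ := hb.surjOn (show v ∈ ((Finset.Icc 1 D.card : Finset ℕ) : Set ℕ) by
      rw [Finset.mem_coe, Finset.mem_Icc]; omega)
    have hpc : p ≠ c := by
      rintro rfl
      omega
    exact ⟨p, Finset.mem_coe.2 (Finset.mem_erase.2 ⟨hpc, hp⟩),
      by rw [Function.update_of_ne hpc, hpv]⟩
  · intro a ha b hb' hab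
    obtain ⟨hac, haD⟩ := Finset.mem_erase.1 ha
    obtain ⟨hbc, hbD⟩ := Finset.mem_erase.1 hb'
    rw [Function.update_of_ne hac, Function.update_of_ne hbc]
    exact hm a haD b hbD hab
  · rw [Function.update_idem, ← hc, Function.update_eq_self]

/-- The largest entry sits in a maximal box, and removing it leaves a tableau. -/
theorem numStandardTableaux_eq_sum {D : Finset (ℕ × ℕ)} (hD : D.Nonempty) :
    numStandardTableaux D = ∑ c ∈ maximalBoxes D, numStandardTableaux (D.erase c) := by
  let φ : (Σ c : maximalBoxes D, fillings (D.erase c.1)) → fillings D :=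
    fun x => ⟨Function.update x.2.1 x.1.1 D.card, update_mem_fillings x.1.2 x.2.2⟩
  have hφ : Function.Bijective φ := by
    constructor
    · rintro ⟨⟨c, hc⟩, ⟨f, hf⟩⟩ ⟨⟨c', hc'⟩, ⟨f', hf'⟩⟩ h
      have h : Function.update f c D.card = Function.update f' c' D.card :=
        congrArg Subtype.val h
      have hcD := (Finset.mem_filter.1 hc).1
      have hcD' := (Finset.mem_filter.1 hc').1
      have hcc : c = c' := by
        refine (update_mem_fillings hc hf).2.1.injOn hcD hcD' ?_
        conv_rhs => rw [h]
        rw [Function.update_self, Function.update_self]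
      subst hcc
      have hff : f = f' := by
        funext p
        by_cases hp : p = c
        · rw [hp, hf.1 c (Finset.notMem_erase c D), hf'.1 c (Finset.notMem_erase c D)]
        · have := congrFun h p
          rwa [Function.update_of_ne hp, Function.update_of_ne hp] at this
      subst hff
      rfl
    · rintro ⟨f, hf⟩
      obtain ⟨c, hc, g, hg, h⟩ := exists_update_eq hD hf
      exact ⟨⟨⟨c, hc⟩, ⟨g, hg⟩⟩, Subtype.ext h⟩
  rw [numStandardTableaux_eq_card, ← Nat.card_congr (Equiv.ofBijective φ hφ), Nat.card_sigma,
    Finset.sum_coe_sort (maximalBoxes D) fun c => Nat.card (fillings (D.erase c))]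
  exact Finset.sum_congr rfl fun c _ => (numStandardTableaux_eq_card _).symm

theorem numStandardTableaux_empty : numStandardTableaux ∅ = 1 := by
  rw [numStandardTableaux_eq_card, Nat.card_eq_one_iff_unique]
  refine ⟨⟨fun f g => Subtype.ext (funext fun p => ?_)⟩, ⟨⟨fun _ => 0, ?_⟩⟩⟩
  · rw [f.2.1 p (Finset.notMem_empty p), g.2.1 p (Finset.notMem_empty p)]
  · refine ⟨fun _ _ => rfl, ?_, fun a ha => absurd ha (Finset.notMem_empty a)⟩
    simp

theorem boxBefore_swap (a b : ℕ × ℕ) : BoxBefore a.swap b.swap ↔ BoxBefore a b := or_comm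

theorem comp_swap_mem_fillings {D : Finset (ℕ × ℕ)} {f : ℕ × ℕ → ℕ} (hf : f ∈ fillings D) :
    f ∘ Prod.swap ∈ fillings (D.map (Equiv.prodComm ℕ ℕ).toEmbedding) := by
  obtain ⟨h0, hb, hm⟩ := hf
  have hmem : ∀ p, p ∈ D.map (Equiv.prodComm ℕ ℕ).toEmbedding ↔ p.swap ∈ D := fun p => by
    rw [Finset.mem_map_equiv]; rfl
  refine ⟨fun p hp => h0 _ fun h => hp ((hmem p).2 h), ?_, fun a ha b hb' hab =>
    hm _ ((hmem a).1 ha) _ ((hmem b).1 hb') ((boxBefore_swap a b).2 hab)⟩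
  rw [Finset.card_map]
  refine hb.comp ⟨fun p hp => (hmem p).1 hp, Prod.swap_injective.injOn, fun p hp => ?_⟩
  exact ⟨p.swap, (hmem _).2 (by simpa using hp), Prod.swap_swap p⟩

/-- Transposing a diagram does not change the number of tableaux. -/
theorem numStandardTableaux_map_swap (D : Finset (ℕ × ℕ)) :
    numStandardTableaux (D.map (Equiv.prodComm ℕ ℕ).toEmbedding) = numStandardTableaux D := by
  rw [numStandardTableaux_eq_card, numStandardTableaux_eq_card]
  refine (Nat.card_congr (Equiv.ofBijective
    (fun f => ⟨f.1 ∘ Prod.swap, comp_swap_mem_fillings f.2⟩) ⟨fun f g h => ?_, fun f => ?_⟩)).symm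
  · have h : f.1 ∘ Prod.swap = g.1 ∘ Prod.swap := congrArg Subtype.val h
    exact Subtype.ext (Prod.swap_surjective.injective_comp_right h)
  · refine ⟨⟨f.1 ∘ Prod.swap, ?_⟩, ?_⟩
    · have := comp_swap_mem_fillings f.2
      rw [Finset.map_map] at this
      convert this
      ext p
      simp
    · apply Subtype.ext
      funext p
      simp

/-! ### Partial fraction identities -/

/-- Common induction step for the three sums below; the weight `g` is later `(w - z i)⁻¹`, `1` or `z
i`. -/
theorem sum_mul_prod_erase_insert {ι : Type*} [DecidableEq ι] {A : Finset ι} {b : ι}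
    (hb : b ∉ A) (η z g : ι → ℚ) :
    ∑ i ∈ insert b A, η i * g i * ∏ j ∈ (insert b A).erase i, (1 - η j / (z i - z j)) =
      η b * g b * ∏ j ∈ A, (1 - η j / (z b - z j)) +
        ∑ i ∈ A, η i * g i * ((1 - η b / (z i - z b)) *
          ∏ j ∈ A.erase i, (1 - η j / (z i - z j))) := by
  rw [Finset.sum_insert hb, Finset.erase_insert hb]
  congr 1
  refine Finset.sum_congr rfl fun i hi => ?_
  have hib : b ≠ i := fun h => hb (h ▸ hi)
  rw [Finset.erase_insert_of_ne hib, Finset.prod_insert fun h => hb (Finset.mem_of_mem_erase h)]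

/-- Partial fraction expansion of `∏ (1 - η j / (w - z j))`. -/
theorem sum_partial_fractions {ι : Type*} [DecidableEq ι] (η z : ι → ℚ) (A : Finset ι)
    (hz : Set.InjOn z A) (w : ℚ) (hw : ∀ i ∈ A, w ≠ z i) :
    ∑ i ∈ A, η i * (w - z i)⁻¹ * ∏ j ∈ A.erase i, (1 - η j / (z i - z j)) =
      1 - ∏ j ∈ A, (1 - η j / (w - z j)) := by
  induction A using Finset.induction_on generalizing w with
  | empty => simp
  | insert b A hb ih =>
    have hzA : Set.InjOn z A := hz.mono (by simp)
    have hwA : ∀ i ∈ A, w ≠ z i := fun i hi => hw i (Finset.mem_insert_of_mem hi)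
    have hzb : ∀ i ∈ A, z b ≠ z i := fun i hi h => hb (by
      have := hz (by simp) (by simp [hi]) h
      rwa [this])
    have hwb : w - z b ≠ 0 := sub_ne_zero.2 (hw b (Finset.mem_insert_self b A))
    rw [sum_mul_prod_erase_insert hb η z fun i => (w - z i)⁻¹, Finset.prod_insert hb]
    have key : ∀ i ∈ A, η i * (w - z i)⁻¹ * ((1 - η b / (z i - z b)) *
        ∏ j ∈ A.erase i, (1 - η j / (z i - z j))) =
        (1 - η b / (w - z b)) *
          (η i * (w - z i)⁻¹ * ∏ j ∈ A.erase i, (1 - η j / (z i - z j))) +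
        η b / (w - z b) *
          (η i * (z b - z i)⁻¹ * ∏ j ∈ A.erase i, (1 - η j / (z i - z j))) := by
      intro i hi
      have h1 : w - z i ≠ 0 := sub_ne_zero.2 (hwA i hi)
      have h2 : z b - z i ≠ 0 := sub_ne_zero.2 (hzb i hi)
      have h3 : z i - z b ≠ 0 := sub_ne_zero.2 (hzb i hi).symm
      have : (w - z i)⁻¹ * (1 - η b / (z i - z b)) =
          (1 - η b / (w - z b)) * (w - z i)⁻¹ + η b / (w - z b) * (z b - z i)⁻¹ := by
        field_simp
        ring
      linear_combination (η i * ∏ j ∈ A.erase i, (1 - η j / (z i - z j))) * this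
    rw [Finset.sum_congr rfl key, Finset.sum_add_distrib, ← Finset.mul_sum, ← Finset.mul_sum,
      ih hzA w hwA, ih hzA (z b) hzb]
    field_simp
    ring

/-- This is the coefficient of `w⁻¹` in `sum_partial_fractions` as `w → ∞`; the induction avoids the
expansion by evaluating that identity at the new pole. -/
theorem sum_mul_prod_eq_sum {ι : Type*} [DecidableEq ι] (η z : ι → ℚ) (A : Finset ι)
    (hz : Set.InjOn z A) :
    ∑ i ∈ A, η i * 1 * ∏ j ∈ A.erase i, (1 - η j / (z i - z j)) = ∑ i ∈ A, η i := by
  induction A using Finset.induction_on with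
  | empty => simp
  | insert b A hb ih =>
    have hzA : Set.InjOn z A := hz.mono (by simp)
    have hzb : ∀ i ∈ A, z b ≠ z i := fun i hi h => hb (by
      have := hz (by simp) (by simp [hi]) h
      rwa [this])
    rw [sum_mul_prod_erase_insert hb η z fun _ => 1, Finset.sum_insert hb]
    have key : ∀ i ∈ A, η i * 1 * ((1 - η b / (z i - z b)) *
        ∏ j ∈ A.erase i, (1 - η j / (z i - z j))) =
        η i * 1 * ∏ j ∈ A.erase i, (1 - η j / (z i - z j)) +
        η b * (η i * (z b - z i)⁻¹ * ∏ j ∈ A.erase i, (1 - η j / (z i - z j))) := by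
      intro i hi
      have h2 : (z b - z i)⁻¹ = - (z i - z b)⁻¹ := by rw [← inv_neg, neg_sub]
      rw [h2, div_eq_mul_inv]
      ring
    rw [Finset.sum_congr rfl key, Finset.sum_add_distrib, ← Finset.mul_sum, ih hzA,
      sum_partial_fractions η z A hzA (z b) hzb]
    ring

/-- This is the coefficient of `w⁻²` in the same expansion; the subtracted term is the second
elementary symmetric function of the `η i`. -/
theorem sum_mul_self_mul_prod_eq {ι : Type*} [DecidableEq ι] (η z : ι → ℚ) (A : Finset ι)
    (hz : Set.InjOn z A) :
    ∑ i ∈ A, η i * z i * ∏ j ∈ A.erase i, (1 - η j / (z i - z j)) =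
      ∑ i ∈ A, η i * z i - ((∑ i ∈ A, η i) ^ 2 - ∑ i ∈ A, η i ^ 2) / 2 := by
  induction A using Finset.induction_on with
  | empty => simp
  | insert b A hb ih =>
    have hzA : Set.InjOn z A := hz.mono (by simp)
    have hzb : ∀ i ∈ A, z b ≠ z i := fun i hi h => hb (by
      have := hz (by simp) (by simp [hi]) h
      rwa [this])
    rw [sum_mul_prod_erase_insert hb η z z, Finset.sum_insert hb, Finset.sum_insert hb,
      Finset.sum_insert hb]
    have key : ∀ i ∈ A, η i * z i * ((1 - η b / (z i - z b)) *
        ∏ j ∈ A.erase i, (1 - η j / (z i - z j))) =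
        η i * z i * ∏ j ∈ A.erase i, (1 - η j / (z i - z j)) +
        η b * z b * (η i * (z b - z i)⁻¹ * ∏ j ∈ A.erase i, (1 - η j / (z i - z j))) -
        η b * (η i * 1 * ∏ j ∈ A.erase i, (1 - η j / (z i - z j))) := by
      intro i hi
      have h2 : z b - z i ≠ 0 := sub_ne_zero.2 (hzb i hi)
      have h3 : z i - z b ≠ 0 := sub_ne_zero.2 (hzb i hi).symm
      have : z i * (1 - η b / (z i - z b)) = z i + η b * z b * (z b - z i)⁻¹ - η b := by
        field_simp
        ring
      linear_combination (η i * ∏ j ∈ A.erase i, (1 - η j / (z i - z j))) * this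
    rw [Finset.sum_congr rfl key, Finset.sum_sub_distrib, Finset.sum_add_distrib,
      ← Finset.mul_sum, ← Finset.mul_sum, ih hzA,
      sum_partial_fractions η z A hzA (z b) hzb, sum_mul_prod_eq_sum η z A hzA]
    ring

/-! ### The signed subset sum and the box removal operator -/

/-- The factor of the pair `i, j` in the term of `tableauSum` indexed by `J`. -/
def pairFactor (J : Finset ℕ) (x : ℕ → ℚ) (i j : ℕ) : ℚ :=
  if i ∈ J ↔ j ∈ J then x i - x j else (if i ∈ J then -1 else 1) / (x i + x j)

/-- The product of the pair factors over all pairs below `n`. -/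
def pairProduct (n : ℕ) (J : Finset ℕ) (x : ℕ → ℚ) : ℚ :=
  ∏ b ∈ Finset.range n, ∏ a ∈ Finset.range b, pairFactor J x a b

/-- The indices that contribute a linear factor to the term of `tableauSum` indexed by `J`. -/
def linearIndices (r n : ℕ) (J : Finset ℕ) : Finset ℕ :=
  if Even r then Finset.range n \ J else J

/-- The term of `tableauSum` indexed by `J`. -/
def tableauTerm (r n : ℕ) (J : Finset ℕ) (x : ℕ → ℚ) : ℚ :=
  (∏ i ∈ linearIndices r n J, x i) * pairProduct n J x

/-- Up to the factor `N! / ∏ xᵢ!`, the number of standard tableaux whose `n` columns, the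
first `d` of which start in the first row, end at heights given by `x`; here `r = n - d`. -/
def tableauSum (r n : ℕ) (x : ℕ → ℚ) : ℚ :=
  (-1) ^ ((r + 1) / 2).choose 2 *
    ∑ J ∈ (Finset.range n).powersetCard (r / 2), tableauTerm r n J x

theorem pairFactor_swap (J : Finset ℕ) (x : ℕ → ℚ) (i j : ℕ) :
    pairFactor J x j i = - pairFactor J x i j := by
  unfold pairFactor
  by_cases hi : i ∈ J <;> by_cases hj : j ∈ J <;> simp [hi, hj, add_comm, neg_div]

theorem prod_pairs_mul (n i : ℕ) (hi : i < n) (ψ : ℕ → ℚ) :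
    ∏ b ∈ Finset.range n, ∏ a ∈ Finset.range b,
      (if a = i then ψ b else if b = i then ψ a else 1) =
      ∏ j ∈ (Finset.range n).erase i, ψ j := by
  have h : ∀ b ∈ Finset.range n, ∏ a ∈ Finset.range b,
      (if a = i then ψ b else if b = i then ψ a else 1) =
      if i < b then ψ b else if b = i then ∏ a ∈ Finset.range i, ψ a else 1 := by
    intro b _
    by_cases h1 : i < b
    · have : b ≠ i := by omega
      simp [this, h1]
    by_cases h2 : b = i
    · subst h2
      rw [if_neg h1, if_pos rfl]
      refine Finset.prod_congr rfl fun a ha => ?_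
      rw [if_neg (Finset.mem_range.1 ha).ne, if_pos rfl]
    · rw [if_neg h1, if_neg h2]
      refine Finset.prod_eq_one fun a ha => ?_
      have := Finset.mem_range.1 ha
      rw [if_neg (by omega), if_neg h2]
  rw [Finset.prod_congr rfl h, ← Finset.mul_prod_erase _ _ (Finset.mem_range.2 hi)]
  rw [if_neg (lt_irrefl i), if_pos rfl]
  have : (Finset.range n).erase i = Finset.range i ∪ Finset.Ioo i n := by
    ext j
    simp only [Finset.mem_erase, Finset.mem_range, Finset.mem_union, Finset.mem_Ioo]
    omega
  have hd : Disjoint (Finset.range i) (Finset.Ioo i n) := by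
    rw [Finset.disjoint_left]
    intro j hj
    simp only [Finset.mem_range, Finset.mem_Ioo] at hj ⊢
    omega
  rw [this, Finset.prod_union hd, Finset.prod_union hd]
  have h1 : ∏ j ∈ Finset.range i,
      (if i < j then ψ j else if j = i then ∏ a ∈ Finset.range i, ψ a else 1) = 1 :=
    Finset.prod_eq_one fun j hj => by
      have := Finset.mem_range.1 hj
      rw [if_neg (by omega), if_neg (by omega)]
  rw [h1, one_mul]
  congr 1
  refine Finset.prod_congr rfl fun j hj => ?_
  rw [if_pos (Finset.mem_Ioo.1 hj).1]

/-- Since `pairFactor` is antisymmetric, the ratio of new to old factor does not depend on the order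
of the pair, so pairs with `i` in first place suffice. -/
theorem pairProduct_of_eq_mul {n i : ℕ} (hi : i < n) {J : Finset ℕ} {x y : ℕ → ℚ} {ψ : ℕ → ℚ}
    (hne : ∀ a b, a ≠ i → b ≠ i → pairFactor J y a b = pairFactor J x a b)
    (h : ∀ b < n, b ≠ i → pairFactor J y i b = pairFactor J x i b * ψ b) :
    pairProduct n J y = pairProduct n J x * ∏ j ∈ (Finset.range n).erase i, ψ j := by
  rw [← prod_pairs_mul n i hi ψ, pairProduct, pairProduct, ← Finset.prod_mul_distrib]
  refine Finset.prod_congr rfl fun b hb => ?_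
  rw [← Finset.prod_mul_distrib]
  refine Finset.prod_congr rfl fun a ha => ?_
  rw [Finset.mem_range] at ha hb
  split_ifs with h1 h2
  · subst h1
    exact h b hb ha.ne'
  · subst h2
    rw [pairFactor_swap, pairFactor_swap J x b a, h a (by omega) h1, neg_mul]
  · rw [mul_one, hne a b h1 h2]

/-- The sign attached to an index in the partial fraction expansion. -/
def sideSign (J : Finset ℕ) (i : ℕ) : ℚ := if i ∈ J then -1 else 1

/-- The pole attached to an index in the partial fraction expansion. -/
def sidePole (J : Finset ℕ) (x : ℕ → ℚ) (i : ℕ) : ℚ := if i ∈ J then 1 - x i else x i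

/-- This is what dictates `sideSign` and `sidePole`: with them, all four positions of `i` and `b`
relative to `J` give a ratio of the one shape to which the partial fraction identities apply. -/
theorem pairFactor_update {J : Finset ℕ} {x : ℕ → ℚ} {i b : ℕ} (hb : b ≠ i)
    (hsub : x i ≠ x b) (hadd : x i + x b ≠ 0) (hadd1 : x i + x b ≠ 1) :
    pairFactor J (Function.update x i (x i - 1)) i b =
      pairFactor J x i b * (1 - sideSign J b / (sidePole J x i - sidePole J x b)) := by
  have h1 : x i - x b ≠ 0 := sub_ne_zero.2 hsub
  have h2 : x b - x i ≠ 0 := sub_ne_zero.2 hsub.symm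
  have h3 : x i + x b - 1 ≠ 0 := sub_ne_zero.2 hadd1
  have h4 : x i - 1 + x b ≠ 0 := by rwa [sub_add_eq_add_sub]
  unfold pairFactor sideSign sidePole
  rw [Function.update_self, Function.update_of_ne hb]
  by_cases hi : i ∈ J <;> by_cases hj : b ∈ J <;> simp only [hi, hj, if_true, if_false, iff_true,
    iff_false, not_true]
  · have : 1 - x i - (1 - x b) ≠ 0 := by
      convert h2 using 1; ring
    field_simp
    ring
  · have : 1 - x i - x b ≠ 0 := fun h => h3 (by linarith)
    field_simp
    ring
  · have : x i - (1 - x b) ≠ 0 := fun h => h3 (by linarith)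
    field_simp
    ring
  · field_simp
    ring

/-- The ratio is `x i - 1` if `i` carries a linear factor and `x i` otherwise. The parity shift
makes both cases a multiple of the sign by an affine function of the pole. -/
theorem linear_mul_update {r n i : ℕ} (hi : i < n) {J : Finset ℕ} {x : ℕ → ℚ} :
    x i * ∏ j ∈ linearIndices r n J, Function.update x i (x i - 1) j =
      (sideSign J i * (sidePole J x i - if Even r then 1 else 0)) *
        ∏ j ∈ linearIndices r n J, x j := by
  by_cases hmem : i ∈ linearIndices r n J
  · rw [Finset.prod_update_of_mem hmem, ← Finset.mul_prod_erase _ _ hmem,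
      Finset.sdiff_singleton_eq_erase]
    unfold linearIndices at hmem
    unfold sideSign sidePole
    by_cases hr : Even r
    · rw [if_pos hr, Finset.mem_sdiff] at hmem
      simp only [hmem.2, hr, if_true, if_false]
      ring
    · rw [if_neg hr] at hmem
      simp only [hmem, hr, if_true, if_false]
      ring
  · rw [Finset.prod_update_of_notMem hmem]
    congr 1
    unfold linearIndices at hmem
    unfold sideSign sidePole
    by_cases hr : Even r
    · rw [if_pos hr, Finset.mem_sdiff, Finset.mem_range] at hmem
      have : i ∈ J := by tauto
      simp only [this, hr, if_true]
      ring
    · rw [if_neg hr] at hmem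
      simp only [hmem, hr, if_false]
      ring

theorem mul_tableauTerm_update {r n i : ℕ} (hi : i < n) {J : Finset ℕ} {x : ℕ → ℚ}
    (hsub : ∀ b < n, b ≠ i → x i ≠ x b) (hadd : ∀ b < n, b ≠ i → x i + x b ≠ 0)
    (hadd1 : ∀ b < n, b ≠ i → x i + x b ≠ 1) :
    x i * tableauTerm r n J (Function.update x i (x i - 1)) =
      (sideSign J i * (sidePole J x i - if Even r then 1 else 0) *
        ∏ j ∈ (Finset.range n).erase i,
          (1 - sideSign J j / (sidePole J x i - sidePole J x j))) * tableauTerm r n J x := by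
  have h := pairProduct_of_eq_mul (n := n) (i := i) hi (J := J) (x := x)
    (y := Function.update x i (x i - 1))
    (ψ := fun j => 1 - sideSign J j / (sidePole J x i - sidePole J x j))
    (fun a b ha hb => by
      unfold pairFactor
      rw [Function.update_of_ne ha, Function.update_of_ne hb])
    (fun b hb hbi => pairFactor_update hbi (hsub b hb hbi) (hadd b hb hbi) (hadd1 b hb hbi))
  rw [tableauTerm, ← mul_assoc, linear_mul_update hi, h, tableauTerm]
  ring

/-- Each term of `tableauSum` is an eigenvector of the box removal operator. -/
theorem sum_mul_tableauTerm_update {d r n : ℕ} (hn : n = d + r) {J : Finset ℕ}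
    (hJ : J ∈ (Finset.range n).powersetCard (r / 2)) {x : ℕ → ℚ}
    (hpos : ∀ a < n, 1 ≤ x a) (hinj : Set.InjOn x (Finset.range n)) :
    ∑ i ∈ Finset.range n, x i * tableauTerm r n J (Function.update x i (x i - 1)) =
      (∑ i ∈ Finset.range n, x i - d * (d + 1) / 2) * tableauTerm r n J x := by
  have hne : ∀ i < n, ∀ b < n, b ≠ i → x i ≠ x b := fun i hi b hb hbi h =>
    hbi (hinj (by simpa using hb) (by simpa using hi) h.symm)
  have hpole : Set.InjOn (sidePole J x) (Finset.range n) := by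
    intro i hi j hj h
    rw [Finset.coe_range, Set.mem_Iio] at hi hj
    have h1 := hpos i hi
    have h2 := hpos j hj
    by_contra hij
    have h3 := hne i hi j hj (Ne.symm hij)
    unfold sidePole at h
    -- Poles on different sides of `J` agree only if `x i + x j = 1`, impossible as both are at
    -- least `1`.
    split_ifs at h
    · exact h3 (by linarith)
    · linarith
    · linarith
    · exact h3 h
  obtain ⟨hJsub, hJcard⟩ := Finset.mem_powersetCard.1 hJ
  rw [Finset.sum_congr rfl fun i hi => mul_tableauTerm_update (Finset.mem_range.1 hi)
      (hne i (Finset.mem_range.1 hi))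
      (fun b hb _ => by
        have h1 := hpos b hb
        have h2 := hpos i (Finset.mem_range.1 hi)
        linarith)
      (fun b hb _ => by
        have h1 := hpos b hb
        have h2 := hpos i (Finset.mem_range.1 hi)
        linarith), ← Finset.sum_mul]
  congr 1
  set α : ℚ := if Even r then 1 else 0 with hα
  have hsplit : ∑ i ∈ Finset.range n, sideSign J i * (sidePole J x i - α) *
        ∏ j ∈ (Finset.range n).erase i,
          (1 - sideSign J j / (sidePole J x i - sidePole J x j)) =
      ∑ i ∈ Finset.range n, sideSign J i * sidePole J x i *
        ∏ j ∈ (Finset.range n).erase i,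
          (1 - sideSign J j / (sidePole J x i - sidePole J x j)) -
      α * ∑ i ∈ Finset.range n, sideSign J i * 1 *
        ∏ j ∈ (Finset.range n).erase i,
          (1 - sideSign J j / (sidePole J x i - sidePole J x j)) := by
    rw [Finset.mul_sum, ← Finset.sum_sub_distrib]
    exact Finset.sum_congr rfl fun i _ => by ring
  rw [hsplit, sum_mul_self_mul_prod_eq _ _ _ hpole, sum_mul_prod_eq_sum _ _ _ hpole]
  have hind : ∑ i ∈ Finset.range n, (if i ∈ J then (1 : ℚ) else 0) = (r / 2 : ℕ) := by
    rw [Finset.sum_ite_mem, Finset.inter_eq_right.2 hJsub, Finset.sum_const, hJcard]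
    simp
  have hs1 : ∑ i ∈ Finset.range n, sideSign J i = n - 2 * (r / 2 : ℕ) := by
    rw [← hind, Finset.mul_sum, Finset.sum_congr rfl fun i _ => show sideSign J i =
      1 - 2 * (if i ∈ J then (1 : ℚ) else 0) by unfold sideSign; split_ifs <;> norm_num,
      Finset.sum_sub_distrib]
    simp
  have hs2 : ∑ i ∈ Finset.range n, sideSign J i ^ 2 = n := by
    rw [Finset.sum_congr rfl fun i _ => show sideSign J i ^ 2 = 1 by
      unfold sideSign; split_ifs <;> norm_num]
    simp
  have hs3 : ∑ i ∈ Finset.range n, sideSign J i * sidePole J x i =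
      ∑ i ∈ Finset.range n, x i - (r / 2 : ℕ) := by
    rw [← hind, ← Finset.sum_sub_distrib]
    refine Finset.sum_congr rfl fun i _ => ?_
    unfold sideSign sidePole
    split_ifs <;> ring
  rw [hs1, hs2, hs3, hn]
  -- The signs add up to `d` for even `r` and to `d + 1` for odd `r`; the shift `α` compensates, so
  -- both parities give the same eigenvalue.
  rcases Nat.even_or_odd' r with ⟨k, rfl | rfl⟩
  · have h2 : 2 * k / 2 = k := by omega
    rw [hα, if_pos (even_two_mul k), h2]
    push_cast
    ring
  · have h2 : (2 * k + 1) / 2 = k := by omega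
    rw [hα, if_neg (by simp), h2]
    push_cast
    ring

theorem sum_mul_tableauSum_update {d r n : ℕ} (hn : n = d + r) {x : ℕ → ℚ}
    (hpos : ∀ a < n, 1 ≤ x a) (hinj : Set.InjOn x (Finset.range n)) :
    ∑ i ∈ Finset.range n, x i * tableauSum r n (Function.update x i (x i - 1)) =
      (∑ i ∈ Finset.range n, x i - d * (d + 1) / 2) * tableauSum r n x := by
  unfold tableauSum
  simp only [Finset.mul_sum]
  rw [Finset.sum_comm]
  refine Finset.sum_congr rfl fun J hJ => ?_
  rw [mul_left_comm, ← sum_mul_tableauTerm_update hn hJ hpos hinj, Finset.mul_sum]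
  exact Finset.sum_congr rfl fun i _ => by ring

/-! ### Boundary values: a zero argument and equal arguments -/

/-- A zero argument turns pair factors into `x i` on its own side of `J` and `± (x i)⁻¹` on the
other, which is what converts one parity's linear factors into the other's. -/
theorem pairProduct_succ_zero {n : ℕ} {J : Finset ℕ} {x : ℕ → ℚ} (hx : x n = 0) :
    pairProduct (n + 1) J x = pairProduct n J x *
      if n ∈ J then (∏ i ∈ Finset.range n ∩ J, x i) * ∏ i ∈ Finset.range n \ J, (x i)⁻¹
      else (∏ i ∈ Finset.range n \ J, x i) * ∏ i ∈ Finset.range n ∩ J, (-(x i)⁻¹) := by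
  rw [pairProduct, Finset.prod_range_succ, ← pairProduct]
  congr 1
  have hsplit := Finset.prod_inter_mul_prod_sdiff (Finset.range n) J fun a => pairFactor J x a n
  rw [← hsplit]
  split_ifs with hn
  · congr 1
    · refine Finset.prod_congr rfl fun i hi => ?_
      have := (Finset.mem_inter.1 hi).2
      simp [pairFactor, this, hn, hx]
    · refine Finset.prod_congr rfl fun i hi => ?_
      have := (Finset.mem_sdiff.1 hi).2
      simp [pairFactor, this, hn, hx]
  · rw [mul_comm]
    congr 1
    · refine Finset.prod_congr rfl fun i hi => ?_
      have := (Finset.mem_sdiff.1 hi).2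
      simp [pairFactor, this, hn, hx]
    · refine Finset.prod_congr rfl fun i hi => ?_
      have := (Finset.mem_inter.1 hi).2
      simp [pairFactor, this, hn, hx, neg_div]

theorem pairProduct_congr {n : ℕ} {J J' : Finset ℕ} {x : ℕ → ℚ}
    (h : ∀ i < n, i ∈ J ↔ i ∈ J') : pairProduct n J x = pairProduct n J' x := by
  refine Finset.prod_congr rfl fun b hb => Finset.prod_congr rfl fun a ha => ?_
  rw [Finset.mem_range] at ha hb
  simp only [pairFactor, h a (by omega), h b hb]

theorem tableauTerm_eq_zero {r n i : ℕ} {J : Finset ℕ} {x : ℕ → ℚ} (hx : x i = 0)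
    (hi : i ∈ linearIndices r n J) : tableauTerm r n J x = 0 := by
  rw [tableauTerm, Finset.prod_eq_zero hi hx, zero_mul]

/-- A column of height zero can be dropped. -/
theorem tableauSum_succ {r n : ℕ} {x : ℕ → ℚ} (hx : x n = 0) (hpos : ∀ i < n, x i ≠ 0) :
    tableauSum (r + 1) (n + 1) x = tableauSum r n x := by
  have hsub : ∀ {k} {J : Finset ℕ}, J ∈ (Finset.range n).powersetCard k →
      J ⊆ Finset.range n ∧ J.card = k ∧ n ∉ J := fun {k J} hJ => by
    obtain ⟨h1, h2⟩ := Finset.mem_powersetCard.1 hJ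
    exact ⟨h1, h2, fun h => by simpa using h1 h⟩
  have hprod : ∀ {J : Finset ℕ}, J ⊆ Finset.range n → ∏ i ∈ J, x i ≠ 0 := fun {J} hJ =>
    Finset.prod_ne_zero_iff.2 fun i hi => hpos i (Finset.mem_range.1 (hJ hi))
  unfold tableauSum
  rcases Nat.even_or_odd' r with ⟨k, rfl | rfl⟩
  · have h1 : (2 * k + 1 + 1) / 2 = k + 1 := by omega
    have h2 : (2 * k + 1) / 2 = k := by omega
    have h3 : 2 * k / 2 = k := by omega
    -- The new parity is odd, so sets containing `n` have the linear factor `x n = 0` and drop out.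
    -- For the others, the `k` signs from pairs `(i, n)` with `i ∈ J` cancel the change `(-1) ^ k`
    -- of the global sign.
    rw [h1, h2, h3, Nat.choose_succ_succ' k 1, Nat.choose_one_right, pow_add, mul_comm ((-1) ^ k),
      mul_assoc]
    congr 1
    rw [Finset.mul_sum]
    have hss : (Finset.range n).powersetCard k ⊆ (Finset.range (n + 1)).powersetCard k :=
      Finset.powersetCard_mono (Finset.range_subset_range.2 n.le_succ)
    rw [← Finset.sum_subset hss]
    · refine Finset.sum_congr rfl fun J hJ => ?_
      obtain ⟨hJ1, hJ2, hJ3⟩ := hsub hJ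
      have hinter : Finset.range n ∩ J = J := Finset.inter_eq_right.2 hJ1
      unfold tableauTerm linearIndices
      rw [pairProduct_succ_zero hx, if_neg hJ3, if_neg (by simp), if_pos (even_two_mul k), hinter,
        Finset.prod_neg, hJ2, Finset.prod_inv_distrib]
      have h4 : ((-1 : ℚ)) ^ k * (-1) ^ k = 1 := by rw [← mul_pow]; simp
      have h5 := mul_inv_cancel₀ (hprod hJ1)
      linear_combination (∏ i ∈ Finset.range n \ J, x i) * pairProduct n J x *
        ((-1 : ℚ) ^ k * (-1) ^ k * h5 + h4)
    · intro J hJ hJ'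
      rw [tableauTerm_eq_zero hx, mul_zero]
      rw [linearIndices, if_neg (by simp)]
      by_contra hn
      refine hJ' (Finset.mem_powersetCard.2 ⟨fun i hi => ?_, (Finset.mem_powersetCard.1 hJ).2⟩)
      have := (Finset.mem_powersetCard.1 hJ).1 hi
      rw [Finset.mem_range] at this ⊢
      have : i ≠ n := fun h => hn (h ▸ hi)
      omega
  · have h1 : (2 * k + 1 + 1) / 2 = k + 1 := by omega
    have h2 : (2 * k + 1) / 2 = k := by omega
    have h3 : (2 * k + 1 + 1 + 1) / 2 = k + 1 := by omega
    rw [h1, h2, h3]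
    congr 1
    -- Now the linear factors run over the complement of the set, so only sets containing `n`
    -- survive; they are the `insert n J` with `J` of size `k`.
    rw [Finset.range_add_one, Finset.powersetCard_succ_insert Finset.notMem_range_self,
      Finset.sum_union, Finset.sum_image, Finset.sum_eq_zero, zero_add]
    · refine Finset.sum_congr rfl fun J hJ => ?_
      obtain ⟨hJ1, hJ2, hJ3⟩ := hsub hJ
      have hinter : Finset.range n ∩ insert n J = J := by
        rw [Finset.inter_insert_of_notMem Finset.notMem_range_self, Finset.inter_eq_right.2 hJ1]
      have hdiff : Finset.range n \ insert n J = Finset.range n \ J := by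
        rw [Finset.sdiff_insert, Finset.erase_eq_of_notMem (by simp)]
      have hdiff' : Finset.range (n + 1) \ insert n J = Finset.range n \ J := by
        rw [Finset.range_add_one, Finset.insert_sdiff_insert, hdiff]
      unfold tableauTerm linearIndices
      rw [pairProduct_succ_zero hx, if_pos (Finset.mem_insert_self n J),
        if_pos (by simp [Nat.even_add_one]), if_neg (by simp), hinter, hdiff, hdiff',
        Finset.prod_inv_distrib, pairProduct_congr (J' := J)]
      · have h5 := mul_inv_cancel₀ (hprod (J := Finset.range n \ J) Finset.sdiff_subset)
        linear_combination (∏ i ∈ J, x i) * pairProduct n J x * h5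
      · intro i hi
        rw [Finset.mem_insert]
        have : i ≠ n := hi.ne
        tauto
    · intro J hJ
      obtain ⟨hJ1, hJ2, hJ3⟩ := hsub hJ
      refine tableauTerm_eq_zero hx ?_
      rw [linearIndices, if_pos (by simp [Nat.even_add_one])]
      simp [hJ3]
    · intro J hJ J' hJ' h
      have h4 := (hsub hJ).2.2
      have h5 := (hsub hJ').2.2
      rw [← Finset.erase_insert h4, ← Finset.erase_insert h5, h]
    · rw [Finset.disjoint_left]
      intro J hJ hJ'
      obtain ⟨J', -, rfl⟩ := Finset.mem_image.1 hJ'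
      exact (hsub hJ).2.2 (Finset.mem_insert_self n J')

theorem pairProduct_eq_sigma (n : ℕ) (J : Finset ℕ) (x : ℕ → ℚ) :
    pairProduct n J x =
      ∏ p ∈ (Finset.range n).sigma fun b => Finset.range b, pairFactor J x p.2 p.1 := by
  rw [Finset.prod_sigma]
  rfl

/-- Transposing `a` and `a + 1` permutes all other ordered pairs and reverses only this one, whence
a single sign. -/
theorem pairProduct_map_swap {n a : ℕ} (ha : a + 1 < n) {J : Finset ℕ} {x : ℕ → ℚ}
    (hx : x a = x (a + 1)) :
    pairProduct n (J.map (Equiv.swap a (a + 1)).toEmbedding) x = - pairProduct n J x := by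
  set τ := Equiv.swap a (a + 1) with hτ
  have hmem : ∀ i, τ i ∈ J.map τ.toEmbedding ↔ i ∈ J := fun i => by
    rw [Finset.mem_map_equiv, Equiv.symm_apply_apply]
  have hxτ : ∀ i, x (τ i) = x i := fun i => by
    rw [hτ, Equiv.swap_apply_def]
    split_ifs with h1 h2
    · rw [h1, hx]
    · rw [h2, hx]
    · rfl
  have hfac : ∀ i j, pairFactor (J.map τ.toEmbedding) x (τ i) (τ j) = pairFactor J x i j :=
    fun i j => by simp only [pairFactor, hmem, hxτ]
  have hval : ∀ i, τ i = if i = a then a + 1 else if i = a + 1 then a else i := fun i =>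
    Equiv.swap_apply_def _ _ _
  set P := (Finset.range n).sigma fun b => Finset.range b with hP
  have h0 : (⟨a + 1, a⟩ : Σ _ : ℕ, ℕ) ∈ P := by simp [hP, ha]
  rw [pairProduct_eq_sigma, pairProduct_eq_sigma, ← hP, ← Finset.mul_prod_erase P _ h0,
    ← Finset.mul_prod_erase P _ h0, ← neg_mul]
  have hadj : pairFactor (J.map τ.toEmbedding) x a (a + 1) = - pairFactor J x a (a + 1) := by
    rw [← pairFactor_swap, ← hfac (a + 1) a]
    simp [hτ]
  rw [hadj]
  congr 1
  have hτP : ∀ p ∈ P.erase ⟨a + 1, a⟩,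
      (⟨τ p.1, τ p.2⟩ : Σ _ : ℕ, ℕ) ∈ P.erase ⟨a + 1, a⟩ := by
    rintro ⟨b, c⟩ hp
    simp only [hP, Finset.mem_erase, Finset.mem_sigma, Finset.mem_range, ne_eq, Sigma.mk.injEq,
      heq_eq_eq] at hp ⊢
    rw [hval, hval]
    split_ifs <;> omega
  refine Finset.prod_nbij' (fun p => ⟨τ p.1, τ p.2⟩) (fun p => ⟨τ p.1, τ p.2⟩) hτP hτP ?_ ?_ ?_
  · rintro ⟨b, c⟩ _
    simp [hτ]
  · rintro ⟨b, c⟩ _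
    simp [hτ]
  · rintro ⟨b, c⟩ _
    rw [← hfac, hτ]
    simp

/-- The sum vanishes when two adjacent arguments agree. -/
theorem tableauSum_eq_zero {r n a : ℕ} (ha : a + 1 < n) {x : ℕ → ℚ} (hx : x a = x (a + 1)) :
    tableauSum r n x = 0 := by
  set τ := Equiv.swap a (a + 1) with hτ
  have hxτ : ∀ i, x (τ i) = x i := fun i => by
    rw [hτ, Equiv.swap_apply_def]
    split_ifs with h1 h2
    · rw [h1, hx]
    · rw [h2, hx]
    · rfl
  have hrange : (Finset.range n).map τ.toEmbedding = Finset.range n := by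
    ext i
    rw [Finset.mem_map_equiv, hτ, Equiv.symm_swap, Equiv.swap_apply_def]
    simp only [Finset.mem_range]
    split_ifs <;> omega
  have hterm : ∀ J, tableauTerm r n (J.map τ.toEmbedding) x = - tableauTerm r n J x := by
    intro J
    have hlin : linearIndices r n (J.map τ.toEmbedding) =
        (linearIndices r n J).map τ.toEmbedding := by
      unfold linearIndices
      split_ifs
      · rw [Finset.map_sdiff, hrange]
      · rfl
    rw [tableauTerm, tableauTerm, pairProduct_map_swap ha hx, hlin, Finset.prod_map, mul_neg]
    congr 2
    exact Finset.prod_congr rfl fun i _ => hxτ i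
  have hmaps : ∀ J ∈ (Finset.range n).powersetCard (r / 2),
      J.map τ.toEmbedding ∈ (Finset.range n).powersetCard (r / 2) := by
    intro J hJ
    rw [Finset.mem_powersetCard] at hJ ⊢
    rw [Finset.card_map]
    refine ⟨?_, hJ.2⟩
    rw [← hrange]
    exact Finset.map_subset_map.2 hJ.1
  have hinv : ∀ J : Finset ℕ, (J.map τ.toEmbedding).map τ.toEmbedding = J := fun J => by
    ext i
    rw [Finset.mem_map_equiv, Finset.mem_map_equiv, hτ]
    simp
  -- The transposition is an involution on the index sets that negates each term, so the sum equals
  -- its own negative.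
  have hsum : ∑ J ∈ (Finset.range n).powersetCard (r / 2), tableauTerm r n J x =
      ∑ J ∈ (Finset.range n).powersetCard (r / 2), - tableauTerm r n J x :=
    Finset.sum_nbij' (fun J => J.map τ.toEmbedding) (fun J => J.map τ.toEmbedding) hmaps hmaps
      (fun J _ => hinv J) (fun J _ => hinv J) fun J _ => by rw [hterm, neg_neg]
  rw [Finset.sum_neg_distrib] at hsum
  rw [tableauSum, self_eq_neg.1 hsum, mul_zero]

/-! ### Counting tableaux of column diagrams -/

/-- The diagram with `n` columns in which column `j` starts in row `j - d` and ends above row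
`x j + j - d`. -/
def columnDiagram (d n : ℕ) (x : ℕ → ℕ) : Finset (ℕ × ℕ) :=
  (Finset.range n).biUnion fun j =>
    (Finset.Ico (j - d) (x j + j - d)).map ⟨fun i => (i, j), fun _ _ h => congrArg Prod.fst h⟩

theorem mem_columnDiagram {d n : ℕ} {x : ℕ → ℕ} {p : ℕ × ℕ} :
    p ∈ columnDiagram d n x ↔ p.2 < n ∧ p.2 ≤ p.1 + d ∧ p.1 + d < x p.2 + p.2 := by
  obtain ⟨i, j⟩ := p
  simp only [columnDiagram, Finset.mem_biUnion, Finset.mem_range, Finset.mem_map, Finset.mem_Ico]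
  constructor
  · rintro ⟨j', h1, i', h2, h3⟩
    obtain ⟨rfl, rfl⟩ := Prod.mk.inj h3
    omega
  · rintro ⟨h1, h2, h3⟩
    exact ⟨j, h1, i, by omega, rfl⟩

theorem add_sub_le_of_strictAnti {n : ℕ} {x : ℕ → ℕ} (hx : ∀ j, j + 1 < n → x (j + 1) < x j)
    {i j : ℕ} (hij : i ≤ j) (hj : j < n) : x j + (j - i) ≤ x i := by
  induction j, hij using Nat.le_induction with
  | base => simp
  | succ j hij ih =>
    have := ih (by omega)
    have := hx j hj
    omega

theorem sub_le_of_strictAnti {n : ℕ} {x : ℕ → ℕ} (hx : ∀ j, j + 1 < n → x (j + 1) < x j)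
    (hpos : ∀ j < n, 1 ≤ x j) {i : ℕ} (hi : i < n) : n - i ≤ x i := by
  have h1 := add_sub_le_of_strictAnti hx (show i ≤ n - 1 by omega) (by omega)
  have h2 := hpos (n - 1) (by omega)
  omega

theorem sum_range_sub_eq (d r : ℕ) : 2 * ∑ j ∈ Finset.range (d + r), (d - j) = d * (d + 1) := by
  rw [Finset.sum_range_add, Finset.sum_eq_zero (s := Finset.range r) fun j _ => by omega, add_zero]
  induction d with
  | zero => simp
  | succ d ih =>
    rw [Finset.sum_range_succ', mul_add, Finset.sum_congr rfl fun j _ =>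
      show d + 1 - (j + 1) = d - j by omega, ih]
    simp only [Nat.sub_zero]
    ring

theorem two_mul_card_columnDiagram {d r n : ℕ} (hn : n = d + r) {x : ℕ → ℕ}
    (hx : ∀ j < n, d - j ≤ x j) :
    2 * (columnDiagram d n x).card + d * (d + 1) = 2 * ∑ j ∈ Finset.range n, x j := by
  have hdisj : ∀ j ∈ Finset.range n, ∀ j' ∈ Finset.range n, j ≠ j' → Disjoint
      ((Finset.Ico (j - d) (x j + j - d)).map
        ⟨fun i => (i, j), fun _ _ h => congrArg Prod.fst h⟩ : Finset (ℕ × ℕ))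
      ((Finset.Ico (j' - d) (x j' + j' - d)).map
        ⟨fun i => (i, j'), fun _ _ h => congrArg Prod.fst h⟩) := by
    intro j _ j' _ hjj
    rw [Finset.disjoint_left]
    intro p hp hp'
    obtain ⟨i, -, rfl⟩ := Finset.mem_map.1 hp
    obtain ⟨i', -, h⟩ := Finset.mem_map.1 hp'
    exact hjj (congrArg Prod.snd h).symm
  rw [columnDiagram, Finset.card_biUnion hdisj, ← sum_range_sub_eq d r, ← hn, ← mul_add,
    ← Finset.sum_add_distrib]
  congr 1
  refine Finset.sum_congr rfl fun j hj => ?_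
  have := hx j (Finset.mem_range.1 hj)
  rw [Finset.card_map, Nat.card_Ico]
  omega

/-- The columns of `columnDiagram d n x` whose last box is maximal. -/
def removableColumns (d n : ℕ) (x : ℕ → ℕ) : Finset ℕ :=
  (Finset.range n).filter fun j => d < x j + j ∧ (j + 1 < n → x (j + 1) + 1 < x j)

/-- A maximal box ends its column. As `x` strictly decreases, the lower ends of the columns weakly
rise to the right, so only the adjacent column can block it. -/
theorem maximalBoxes_columnDiagram {d n : ℕ} {x : ℕ → ℕ}
    (hx : ∀ j, j + 1 < n → x (j + 1) < x j) (hpos : ∀ j < n, 1 ≤ x j) :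
    maximalBoxes (columnDiagram d n x) =
      (removableColumns d n x).image fun j => (x j + j - d - 1, j) := by
  ext ⟨i, j⟩
  rw [maximalBoxes, Finset.mem_filter]
  simp only [removableColumns, Finset.mem_filter, Finset.mem_image,
    mem_columnDiagram, Finset.mem_range, BoxBefore, Prod.mk.injEq]
  constructor
  · rintro ⟨⟨h1, h2, h3⟩, hmax⟩
    have hi : i + d + 1 = x j + j := by
      by_contra hne
      exact hmax (i + 1, j) ⟨h1, by dsimp; omega, by dsimp; omega⟩ (Or.inr ⟨rfl, by simp⟩)
    refine ⟨j, ⟨h1, by omega, fun hj => ?_⟩, by omega, rfl⟩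
    by_contra hlt
    have h4 := hx j hj
    have h5 := hpos _ hj
    exact hmax (i, j + 1) ⟨hj, by dsimp; omega, by dsimp; omega⟩ (Or.inl ⟨rfl, by simp⟩)
  · rintro ⟨j', ⟨h1, h2, h3⟩, h4, rfl⟩
    have h5 := hpos _ h1
    refine ⟨⟨h1, by omega, by omega⟩, ?_⟩
    rintro ⟨a, b⟩ ⟨h6, h7, h8⟩ (⟨h9, h10⟩ | ⟨h9, h10⟩)
    · dsimp at h6 h7 h8 h9 h10
      have h11 := add_sub_le_of_strictAnti hx (show j' + 1 ≤ b by omega) h6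
      have h12 := h3 (by omega)
      omega
    · dsimp at h6 h7 h8 h9 h10
      subst h9
      omega

theorem columnDiagram_erase {d n j : ℕ} {x : ℕ → ℕ} (hj : j ∈ removableColumns d n x) :
    (columnDiagram d n x).erase (x j + j - d - 1, j) =
      columnDiagram d n (Function.update x j (x j - 1)) := by
  obtain ⟨h1, h2, h3⟩ := Finset.mem_filter.1 hj
  ext ⟨a, b⟩
  simp only [Finset.mem_erase, mem_columnDiagram, ne_eq, Prod.mk.injEq]
  by_cases hb : b = j
  · subst hb
    rw [Function.update_self]
    omega
  · rw [Function.update_of_ne hb]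
    tauto

theorem columnDiagram_succ {d n : ℕ} {x : ℕ → ℕ} (hx : x n = 0) :
    columnDiagram d (n + 1) x = columnDiagram d n x := by
  ext ⟨a, b⟩
  simp only [mem_columnDiagram]
  by_cases hb : b = n
  · subst hb
    omega
  · omega

theorem tableauSum_zero_left (n : ℕ) (x : ℕ → ℚ) :
    tableauSum 0 n x = (∏ i ∈ Finset.range n, x i) *
      ∏ b ∈ Finset.range n, ∏ a ∈ Finset.range b, (x a - x b) := by
  simp [tableauSum, tableauTerm, linearIndices, pairProduct, pairFactor]

theorem prod_range_natCast_sub (b : ℕ) :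
    ∏ a ∈ Finset.range b, ((b : ℚ) - a) = (b.factorial : ℚ) := by
  rw [← Finset.prod_range_add_one_eq_factorial, Nat.cast_prod, ← Finset.prod_range_reflect]
  refine Finset.prod_congr rfl fun a ha => ?_
  rw [Finset.mem_range] at ha
  rw [← Nat.cast_sub (by omega)]
  congr 1
  omega

/-- These are the arguments of the empty diagram with `d` columns, the base of the induction. -/
theorem tableauSum_zero_staircase (d : ℕ) {x : ℕ → ℕ} (hx : ∀ j < d, x j = d - j) :
    tableauSum 0 d (fun j => (x j : ℚ)) = ∏ j ∈ Finset.range d, ((x j).factorial : ℚ) := by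
  have hx' : ∀ j < d, (x j : ℚ) = d - j := fun j hj => by
    rw [hx j hj, Nat.cast_sub hj.le]
  have h : ∏ b ∈ Finset.range d, ∏ a ∈ Finset.range b, ((x a : ℚ) - x b) =
      ∏ b ∈ Finset.range d, (b.factorial : ℚ) := by
    refine Finset.prod_congr rfl fun b hb => ?_
    rw [Finset.mem_range] at hb
    rw [← prod_range_natCast_sub]
    refine Finset.prod_congr rfl fun a ha => ?_
    rw [Finset.mem_range] at ha
    rw [hx' a (by omega), hx' b hb]
    ring
  rw [tableauSum_zero_left, h, ← Finset.prod_range_reflect (fun b => (b.factorial : ℚ)),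
    ← Finset.prod_mul_distrib]
  refine Finset.prod_congr rfl fun j hj => ?_
  rw [Finset.mem_range] at hj
  rw [hx j hj, ← Nat.cast_mul]
  congr 1
  rw [show d - j = d - 1 - j + 1 by omega, Nat.factorial_succ]

theorem prod_factorial_eq_mul {n j : ℕ} (hj : j < n) {x : ℕ → ℕ} (hpos : 1 ≤ x j) :
    ∏ i ∈ Finset.range n, ((x i).factorial : ℚ) =
      x j * ∏ i ∈ Finset.range n, ((Function.update x j (x j - 1) i).factorial : ℚ) := by
  have hj' := Finset.mem_range.2 hj
  rw [← Finset.mul_prod_erase _ _ hj', ← Finset.mul_prod_erase _ _ hj', ← mul_assoc]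
  congr 1
  · rw [Function.update_self, ← Nat.cast_mul, Nat.mul_factorial_pred (by omega)]
  · refine Finset.prod_congr rfl fun i hi => ?_
    rw [Function.update_of_ne (Finset.ne_of_mem_erase hi)]

theorem natCast_update {x : ℕ → ℕ} {j : ℕ} (hpos : 1 ≤ x j) :
    (fun i => ((Function.update x j (x j - 1) i : ℕ) : ℚ)) =
      Function.update (fun i => (x i : ℚ)) j ((x j : ℚ) - 1) := by
  funext i
  by_cases hi : i = j
  · subst hi
    simp [Nat.cast_sub hpos]
  · simp [Function.update_of_ne hi]

/-- Either lowering `x j` makes it equal to `x (j + 1)`, or column `j` is the last one and has no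
boxes. The latter forces `r = 0` and `x j = 1`, and a linear factor vanishes. -/
theorem tableauSum_update_eq_zero {d r n j : ℕ} (hn : n = d + r) {x : ℕ → ℕ}
    (hx : ∀ j, j + 1 < n → x (j + 1) < x j) (hpos : ∀ j < n, 1 ≤ x j)
    (hj : j < n) (hjr : j ∉ removableColumns d n x) :
    tableauSum r n (fun i => ((Function.update x j (x j - 1) i : ℕ) : ℚ)) = 0 := by
  have hle := sub_le_of_strictAnti hx hpos hj
  by_cases h : j + 1 < n ∧ x j = x (j + 1) + 1
  · refine tableauSum_eq_zero h.1 ?_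
    rw [Function.update_self, Function.update_of_ne (by omega)]
    congr 1
    omega
  · have h1 : ¬ j + 1 < n := by
      intro h1
      have h2 := hx j h1
      have h3 := sub_le_of_strictAnti hx hpos h1
      refine hjr (Finset.mem_filter.2 ⟨Finset.mem_range.2 hj, ?_, fun _ => ?_⟩) <;> omega
    have h2 : x j + j ≤ d := by
      by_contra h2
      exact hjr (Finset.mem_filter.2 ⟨Finset.mem_range.2 hj, by omega, fun h3 => absurd h3 h1⟩)
    have h3 : r = 0 := by omega
    have h4 : x j = 1 := by
      have := hpos j hj
      omega
    subst h3
    rw [tableauSum_zero_left, Finset.prod_eq_zero (Finset.mem_range.2 hj), zero_mul]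
    simp [h4]

/-- The number of standard tableaux of a diagram made of columns. -/
theorem numStandardTableaux_columnDiagram {d r n : ℕ} (hn : n = d + r) {x : ℕ → ℕ}
    (hx : ∀ j, j + 1 < n → x (j + 1) < x j) (hpos : ∀ j < n, 1 ≤ x j) :
    (numStandardTableaux (columnDiagram d n x) : ℚ) * ∏ j ∈ Finset.range n, ((x j).factorial : ℚ) =
      ((columnDiagram d n x).card.factorial : ℚ) * tableauSum r n fun j => (x j : ℚ) := by
  induction hN : (columnDiagram d n x).card generalizing r n x with
  | zero =>
    rw [Finset.card_eq_zero] at hN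
    have h0 : ∀ p, p ∉ columnDiagram d n x := by simp [hN]
    have hr : r = 0 := by
      by_contra hr
      have h1 := hpos d (by omega)
      exact h0 (0, d) (mem_columnDiagram.2 ⟨by dsimp; omega, by dsimp; omega, by dsimp; omega⟩)
    subst hr
    have hxd : ∀ j < d, x j = d - j := by
      intro j hj
      have h1 := sub_le_of_strictAnti hx hpos (show j < n by omega)
      by_contra h2
      exact h0 (0, j) (mem_columnDiagram.2 ⟨by dsimp; omega, by dsimp; omega, by dsimp; omega⟩)
    rw [hN, numStandardTableaux_empty]
    have hnd : n = d := hn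
    subst hnd
    rw [tableauSum_zero_staircase n hxd]
    simp
  | succ N ih =>
    have hne : (columnDiagram d n x).Nonempty := Finset.card_pos.1 (by omega)
    have hle : ∀ j < n, d - j ≤ x j := fun j hj => by
      have := sub_le_of_strictAnti hx hpos hj
      omega
    -- The eigenvalue of the removal operator is the number of boxes.
    have hcard : ((N : ℚ) + 1) = ∑ j ∈ Finset.range n, (x j : ℚ) - d * (d + 1) / 2 := by
      have h1 := two_mul_card_columnDiagram hn hle
      rw [hN] at h1
      have h2 : (2 * ((N : ℚ) + 1) + d * (d + 1)) = 2 * ∑ j ∈ Finset.range n, (x j : ℚ) := by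
        exact_mod_cast h1
      linarith
    have hinj : Set.InjOn (fun j => (x j : ℚ)) (Finset.range n) := by
      intro i hi j hj h
      have h : x i = x j := Nat.cast_injective h
      rw [Finset.coe_range, Set.mem_Iio] at hi hj
      rcases lt_trichotomy i j with hij | hij | hij
      · have := add_sub_le_of_strictAnti hx hij.le hj
        omega
      · exact hij
      · have := add_sub_le_of_strictAnti hx hij.le hi
        omega
    have hrec := sum_mul_tableauSum_update hn
      (fun a ha => by exact_mod_cast hpos a ha) hinj
    rw [← hcard] at hrec
    rw [numStandardTableaux_eq_sum hne, maximalBoxes_columnDiagram hx hpos,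
      Finset.sum_image fun i _ j _ h => congrArg Prod.snd h, Nat.factorial_succ, Nat.cast_mul,
      Nat.cast_add_one, mul_comm ((N : ℚ) + 1), mul_assoc, ← hrec, Nat.cast_sum, Finset.sum_mul,
      Finset.mul_sum]
    -- The tableau recursion sums over removable columns, the eigenvector equation over all columns;
    -- the extra terms are zero.
    refine Finset.sum_subset_zero_on_sdiff (Finset.filter_subset _ _) ?_ ?_
    · intro j hj
      rw [Finset.mem_sdiff, Finset.mem_range] at hj
      rw [← natCast_update (hpos j hj.1), tableauSum_update_eq_zero hn hx hpos hj.1 hj.2]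
      simp
    · intro j hj
      obtain ⟨h1, h2, h3⟩ := Finset.mem_filter.1 hj
      rw [Finset.mem_range] at h1
      have hcell : (x j + j - d - 1, j) ∈ columnDiagram d n x := by
        have : (x j + j - d - 1, j) ∈ maximalBoxes (columnDiagram d n x) := by
          rw [maximalBoxes_columnDiagram hx hpos]
          exact Finset.mem_image_of_mem _ hj
        exact (Finset.mem_filter.1 this).1
      have hcard' := Finset.card_erase_add_one hcell
      rw [columnDiagram_erase hj, hN] at hcard'
      rw [columnDiagram_erase hj, ← natCast_update (hpos j h1),
        prod_factorial_eq_mul h1 (hpos j h1), mul_left_comm, mul_left_comm (N.factorial : ℚ)]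
      congr 1
      set y := Function.update x j (x j - 1) with hy
      have hyj : y j = x j - 1 := Function.update_self _ _ _
      have hyne : ∀ i, i ≠ j → y i = x i := fun i hi => Function.update_of_ne hi _ _
      have hy_anti : ∀ i, i + 1 < n → y (i + 1) < y i := by
        intro i hi
        have h4 := hx i hi
        by_cases hij : i = j
        · subst hij
          rw [hyj, hyne _ (by omega)]
          have := h3 hi
          omega
        · rw [hyne i hij]
          by_cases hij' : i + 1 = j
          · rw [hij', hyj]
            rw [hij'] at h4
            omega
          · rwa [hyne _ hij']
      have hy_pos : ∀ i < n, i ≠ j → 1 ≤ y i := fun i hi hij => by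
        rw [hyne i hij]
        exact hpos i hi
      -- If `x j` drops to `0`, the column is the last one and disappears: the induction hypothesis
      -- is applied with `n` and `r` both smaller by one.
      by_cases hxj : x j = 1
      · have h4 : j + 1 = n := by
          by_contra h4
          have h5 := hx j (by omega)
          have h6 := hpos (j + 1) (by omega)
          omega
        obtain ⟨r', rfl⟩ : ∃ r', r = r' + 1 := ⟨r - 1, by omega⟩
        subst h4
        have hyj0 : y j = 0 := by omega
        rw [columnDiagram_succ hyj0] at hcard' ⊢
        have hyne' : ∀ i < j, i ≠ j := fun i hi => hi.ne
        rw [tableauSum_succ (by simp [hyj0]) (fun i hi => by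
            have := hy_pos i (by omega) hi.ne
            positivity), Finset.prod_range_succ, hyj0, Nat.factorial_zero, Nat.cast_one, mul_one]
        exact ih (by omega) (fun i hi => hy_anti i (by omega))
          (fun i hi => hy_pos i (by omega) hi.ne) (by omega)
      · refine ih hn hy_anti (fun i hi => ?_) (by omega)
        by_cases hij : i = j
        · subst hij
          have := hpos i hi
          omega
        · exact hy_pos i hi hij

/-! ### Andréief's identity and subset sums as determinants -/

theorem sum_prod_mul_det {k : ℕ} (A : Finset ℕ) (v F : Fin k → ℕ → ℚ) :
    ∑ p ∈ Fintype.piFinset fun _ : Fin k => A,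
      (∏ b, v b (p b)) * (Matrix.of fun a b => F a (p b)).det =
      (Matrix.of fun a b => ∑ j ∈ A, v b j * F a j).det := by
  simp only [Matrix.det_apply', Matrix.of_apply, Finset.mul_sum, Finset.prod_univ_sum]
  rw [Finset.sum_comm]
  refine Finset.sum_congr rfl fun σ _ => Finset.sum_congr rfl fun p _ => ?_
  rw [Finset.prod_mul_distrib]
  ring

/-- Andréief's identity. -/
theorem sum_prod_mul_det_mul_det {k : ℕ} (A : Finset ℕ) (w : ℕ → ℚ) (F G : Fin k → ℕ → ℚ) :
    ∑ p ∈ Fintype.piFinset fun _ : Fin k => A,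
      (∏ b, w (p b)) * ((Matrix.of fun a b => F a (p b)).det *
        (Matrix.of fun a b => G a (p b)).det) =
      k.factorial * (Matrix.of fun a b => ∑ j ∈ A, w j * F a j * G b j).det := by
  set M : Matrix (Fin k) (Fin k) ℚ := Matrix.of fun a b => ∑ j ∈ A, w j * F a j * G b j with hM
  -- Each permutation in the expansion of the second determinant gives the same value: its sign is
  -- cancelled by that of the column permutation.
  have key : ∀ σ : Equiv.Perm (Fin k), ((σ.sign : ℤ) : ℚ) *
      ∑ p ∈ Fintype.piFinset fun _ : Fin k => A,
        (∏ b, w (p b) * G (σ b) (p b)) * (Matrix.of fun a b => F a (p b)).det = M.det := by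
    intro σ
    rw [sum_prod_mul_det A (fun b j => w j * G (σ b) j) F]
    have : (Matrix.of fun a b => ∑ j ∈ A, w j * G (σ b) j * F a j) = M.submatrix id σ := by
      ext a b
      simp only [hM, Matrix.of_apply, Matrix.submatrix_apply, id]
      exact Finset.sum_congr rfl fun j _ => by ring
    rw [this, Matrix.det_permute', ← mul_assoc, ← Int.cast_mul, ← Units.val_mul,
      Int.units_mul_self]
    simp
  have hcard : (k.factorial : ℚ) * M.det = ∑ _σ : Equiv.Perm (Fin k), M.det := by
    rw [Finset.sum_const, Finset.card_univ, Fintype.card_perm, Fintype.card_fin, nsmul_eq_mul]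
  rw [hcard, ← Finset.sum_congr rfl fun σ _ => key σ]
  simp only [Finset.mul_sum]
  rw [Finset.sum_comm]
  refine Finset.sum_congr rfl fun p _ => ?_
  rw [Matrix.det_apply' (Matrix.of fun a b => G a (p b)), Finset.mul_sum, Finset.mul_sum]
  refine Finset.sum_congr rfl fun σ _ => ?_
  rw [Finset.prod_mul_distrib]
  simp only [Matrix.of_apply]
  ring

/-- The number of orderings of a `k`-element set is `k!`. -/
theorem card_filter_injective_image {k : ℕ} {A J : Finset ℕ} (hJ : J ∈ A.powersetCard k) :
    (((Fintype.piFinset fun _ : Fin k => A).filter Function.Injective).filter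
      fun p => Finset.univ.image p = J).card = k.factorial := by
  obtain ⟨hJA, hJk⟩ := Finset.mem_powersetCard.1 hJ
  have hcard : (Finset.univ : Finset (Fin k ≃ J)).card = k.factorial := by
    have e : Fin k ≃ J := (Fintype.equivFinOfCardEq (by simpa using hJk)).symm
    rw [Finset.card_univ, Fintype.card_equiv e, Fintype.card_fin]
  rw [← hcard]
  symm
  refine Finset.card_bij (fun e _ b => (e b : ℕ)) ?_ ?_ ?_
  · intro e _
    rw [Finset.mem_filter, Finset.mem_filter, Fintype.mem_piFinset]
    refine ⟨⟨fun b => hJA (e b).2, Subtype.val_injective.comp e.injective⟩, ?_⟩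
    ext j
    simp only [Finset.mem_image, Finset.mem_univ, true_and]
    exact ⟨fun ⟨b, hb⟩ => hb ▸ (e b).2, fun hj => ⟨e.symm ⟨j, hj⟩, by simp⟩⟩
  · intro e _ e' _ h
    ext b
    exact congrFun h b
  · intro p hp
    rw [Finset.mem_filter, Finset.mem_filter] at hp
    obtain ⟨⟨-, hinj⟩, himg⟩ := hp
    refine ⟨Equiv.ofBijective (fun b => ⟨p b, himg ▸ Finset.mem_image_of_mem p (Finset.mem_univ b)⟩)
      ⟨fun a b h => hinj (congrArg Subtype.val h), fun j => ?_⟩, Finset.mem_univ _, rfl⟩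
    obtain ⟨b, -, hb⟩ := Finset.mem_image.1 (himg.symm ▸ j.2 : j.1 ∈ Finset.univ.image p)
    exact ⟨b, Subtype.ext hb⟩

theorem sum_injective_eq {k : ℕ} (A : Finset ℕ) (Φ : Finset ℕ → ℚ) :
    ∑ p ∈ (Fintype.piFinset fun _ : Fin k => A).filter Function.Injective,
      Φ (Finset.univ.image p) = k.factorial * ∑ J ∈ A.powersetCard k, Φ J := by
  rw [← Finset.sum_fiberwise_of_maps_to (t := A.powersetCard k)
    (g := fun p : Fin k → ℕ => Finset.univ.image p), Finset.mul_sum]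
  · refine Finset.sum_congr rfl fun J hJ => ?_
    rw [Finset.sum_congr rfl fun p hp => by rw [(Finset.mem_filter.1 hp).2], Finset.sum_const,
      card_filter_injective_image hJ, nsmul_eq_mul]
  · intro p hp
    rw [Finset.mem_filter, Fintype.mem_piFinset] at hp
    rw [Finset.mem_powersetCard, Finset.card_image_of_injective _ hp.2]
    refine ⟨fun j hj => ?_, by simp⟩
    obtain ⟨b, -, rfl⟩ := Finset.mem_image.1 hj
    exact hp.1 b

/-- The divided difference type sum of `h` over the nodes `y j`, `j ∈ A`. -/
def nodeSum (h y : ℕ → ℚ) (A : Finset ℕ) : ℚ :=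
  ∑ j ∈ A, h j * ∏ i ∈ A.erase j, (y i - y j)⁻¹

/-- The analogue of `nodeSum` for `k`-element subsets. -/
def subsetSum (h y : ℕ → ℚ) (k : ℕ) (A : Finset ℕ) : ℚ :=
  ∑ J ∈ A.powersetCard k, ∏ j ∈ J, (h j * ∏ i ∈ A \ J, (y i - y j)⁻¹)

/-- The sign of the reversal of `k` letters. -/
def reversalSign (k : ℕ) : ℚ := ∏ a : Fin k, ∏ _b ∈ Finset.Ioi a, (-1)

theorem reversalSign_mul_self (k : ℕ) : reversalSign k * reversalSign k = 1 := by
  simp only [reversalSign, Finset.prod_const, ← Finset.prod_mul_distrib, ← mul_pow]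
  simp

/-- Each pair occurs in both orders, so the product is the squared Vandermonde determinant up to one
sign per pair. -/
theorem prod_prod_erase_sub {k : ℕ} (v : Fin k → ℚ) :
    ∏ b, ∏ a ∈ Finset.univ.erase b, (v a - v b) =
      reversalSign k * ((Matrix.vandermonde v).det * (Matrix.vandermonde v).det) := by
  have h : ∀ b : Fin k, ∏ a ∈ Finset.univ.erase b, (v a - v b) =
      (∏ a ∈ Finset.Ioi b, (v a - v b)) * ∏ a ∈ Finset.Iio b, (v a - v b) := by
    intro b
    rw [← Finset.prod_union]
    · congr 1
      ext a
      simp only [Finset.mem_erase, Finset.mem_univ, and_true, Finset.mem_union, Finset.mem_Ioi,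
        Finset.mem_Iio]
      exact ne_iff_gt_or_lt
    · rw [Finset.disjoint_left]
      intro a ha hb
      exact lt_asymm (Finset.mem_Ioi.1 ha) (Finset.mem_Iio.1 hb)
  have h2 : ∏ b, ∏ a ∈ Finset.Iio b, (v a - v b) = ∏ a, ∏ b ∈ Finset.Ioi a, (v a - v b) :=
    Finset.prod_comm' (by simp)
  have h3 : ∏ a, ∏ b ∈ Finset.Ioi a, (v a - v b) =
      reversalSign k * (Matrix.vandermonde v).det := by
    rw [Matrix.det_vandermonde, reversalSign]
    simp only [← Finset.prod_mul_distrib]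
    exact Finset.prod_congr rfl fun a _ => Finset.prod_congr rfl fun b _ => by ring
  rw [Finset.prod_congr rfl fun b _ => h b, Finset.prod_mul_distrib, h2, h3,
    Matrix.det_vandermonde]
  ring

theorem det_eval_eq_det_vandermonde {k : ℕ} (p : Fin k → Polynomial ℚ)
    (hdeg : ∀ a, (p a).natDegree = a) (hmonic : ∀ a, (p a).Monic) (v : Fin k → ℚ) :
    (Matrix.of fun a b => (p a).eval (v b)).det = (Matrix.vandermonde v).det := by
  rw [Matrix.det_eval_matrixOfPolynomials_eq_det_vandermonde v p hdeg hmonic,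
    ← Matrix.det_transpose]
  rfl

/-- A subset sum is, up to sign, a determinant. -/
theorem subsetSum_eq_det {k : ℕ} (h y : ℕ → ℚ) (A : Finset ℕ) (hy : Set.InjOn y A)
    (p q : Fin k → Polynomial ℚ)
    (hpdeg : ∀ a, (p a).natDegree = a) (hpmonic : ∀ a, (p a).Monic)
    (hqdeg : ∀ a, (q a).natDegree = a) (hqmonic : ∀ a, (q a).Monic) :
    subsetSum h y k A = reversalSign k *
      (Matrix.of fun a b : Fin k => ∑ j ∈ A, (h j * ∏ i ∈ A.erase j, (y i - y j)⁻¹) *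
        (p a).eval (y j) * (q b).eval (y j)).det := by
  have hk : (k.factorial : ℚ) ≠ 0 := by positivity
  apply mul_left_cancel₀ hk
  rw [mul_left_comm, ← sum_prod_mul_det_mul_det A
    (fun j => h j * ∏ i ∈ A.erase j, (y i - y j)⁻¹) (fun a j => (p a).eval (y j))
    (fun a j => (q a).eval (y j)), subsetSum, ← sum_injective_eq, Finset.mul_sum,
    Finset.sum_filter]
  refine Finset.sum_congr rfl fun f hf => ?_
  rw [Fintype.mem_piFinset] at hf
  rw [det_eval_eq_det_vandermonde p hpdeg hpmonic fun b => y (f b),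
    det_eval_eq_det_vandermonde q hqdeg hqmonic fun b => y (f b)]
  split_ifs with hinj
  · set J := Finset.univ.image f with hJ
    have hJA : J ⊆ A := fun j hj => by
      obtain ⟨b, -, rfl⟩ := Finset.mem_image.1 hj
      exact hf b
    -- The factors inside `J` multiply to the inverse squared Vandermonde up to sign, exactly
    -- cancelling the two determinants in Andréief's identity.
    have hterm : ∀ b, ∏ i ∈ A.erase (f b), (y i - y (f b))⁻¹ =
        (∏ i ∈ A \ J, (y i - y (f b))⁻¹) *
          ∏ a ∈ Finset.univ.erase b, (y (f a) - y (f b))⁻¹ := by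
      intro b
      have hset : A.erase (f b) = (A \ J) ∪ (Finset.univ.erase b).image f := by
        ext i
        simp only [hJ, Finset.mem_erase, Finset.mem_union, Finset.mem_sdiff, Finset.mem_image,
          Finset.mem_univ, true_and, and_true]
        constructor
        · rintro ⟨h1, h2⟩
          by_cases h3 : ∃ a, f a = i
          · obtain ⟨a, rfl⟩ := h3
            exact Or.inr ⟨a, fun h4 => h1 (h4 ▸ rfl), rfl⟩
          · exact Or.inl ⟨h2, h3⟩
        · rintro (⟨h1, h2⟩ | ⟨a, h1, rfl⟩)
          · exact ⟨fun h3 => h2 ⟨b, h3.symm⟩, h1⟩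
          · exact ⟨fun h2 => h1 (hinj h2), hf a⟩
      rw [hset, Finset.prod_union, Finset.prod_image hinj.injOn]
      rw [Finset.disjoint_left]
      intro i hi hi'
      obtain ⟨a, -, rfl⟩ := Finset.mem_image.1 hi'
      exact (Finset.mem_sdiff.1 hi).2 (Finset.mem_image_of_mem f (Finset.mem_univ a))
    have hV : (Matrix.vandermonde fun b => y (f b)).det ≠ 0 :=
      Matrix.det_vandermonde_ne_zero_iff.2 fun a b hab => hinj (hy (hf a) (hf b) hab)
    rw [Finset.prod_image hinj.injOn, Finset.prod_mul_distrib, Finset.prod_mul_distrib,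
      Finset.prod_congr rfl fun b _ => hterm b, Finset.prod_mul_distrib]
    have h1 : ∏ b, ∏ a ∈ Finset.univ.erase b, (y (f a) - y (f b))⁻¹ =
        (reversalSign k * ((Matrix.vandermonde fun b => y (f b)).det *
          (Matrix.vandermonde fun b => y (f b)).det))⁻¹ := by
      rw [← prod_prod_erase_sub]
      simp only [Finset.prod_inv_distrib]
    rw [h1, mul_inv]
    have h2 : reversalSign k * (reversalSign k)⁻¹ = 1 := mul_inv_cancel₀ fun h0 => by
      have := reversalSign_mul_self k
      rw [h0] at this
      norm_num at this
    have h3 := mul_inv_cancel₀ (mul_ne_zero hV hV)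
    generalize (Matrix.vandermonde fun b => y (f b)).det *
      (Matrix.vandermonde fun b => y (f b)).det = V at h3 ⊢
    linear_combination (-(∏ b, h (f b)) * ∏ b, ∏ i ∈ A \ J, (y i - y (f b))⁻¹) *
      (reversalSign k * (reversalSign k)⁻¹ * h3 + h2)
  · have hV : (Matrix.vandermonde fun b => y (f b)).det = 0 := by
      by_contra hV
      exact hinj fun a b hab => Matrix.det_vandermonde_ne_zero_iff.1 hV (congrArg y hab)
    rw [hV]
    ring

theorem natDegree_prod_X_sub_C (y : ℕ → ℚ) (B : Finset ℕ) :
    (∏ t ∈ B, (Polynomial.X - Polynomial.C (y t))).natDegree = B.card := by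
  rw [Polynomial.natDegree_prod_of_monic _ _ fun t _ => Polynomial.monic_X_sub_C _]
  simp

/-- The two polynomials vanish at the first `a` and last `b` nodes. At the remaining nodes they
cancel the corresponding denominators up to sign, leaving a sum over an interval. -/
theorem nodeSum_mul_eval {h y : ℕ → ℚ} {n : ℕ} (hy : Set.InjOn y (Finset.range n)) {a b : ℕ}
    (hab : a + b ≤ n) :
    ∑ j ∈ Finset.range n, (h j * ∏ i ∈ (Finset.range n).erase j, (y i - y j)⁻¹) *
      (∏ t ∈ Finset.range a, (Polynomial.X - Polynomial.C (y t))).eval (y j) *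
      (∏ t ∈ Finset.Ico (n - b) n, (Polynomial.X - Polynomial.C (y t))).eval (y j) =
    (-1) ^ a * (-1) ^ b * nodeSum h y (Finset.Ico a (n - b)) := by
  simp only [Polynomial.eval_prod, Polynomial.eval_sub, Polynomial.eval_X, Polynomial.eval_C]
  have hsub : Finset.Ico a (n - b) ⊆ Finset.range n := fun j hj => by
    rw [Finset.mem_Ico] at hj
    rw [Finset.mem_range]
    omega
  rw [← Finset.sum_subset hsub, nodeSum, Finset.mul_sum]
  · refine Finset.sum_congr rfl fun j hj => ?_
    rw [Finset.mem_Ico] at hj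
    have hset : (Finset.range n).erase j =
        (Finset.range a ∪ Finset.Ico (n - b) n) ∪ (Finset.Ico a (n - b)).erase j := by
      ext i
      simp only [Finset.mem_erase, Finset.mem_union, Finset.mem_range, Finset.mem_Ico]
      omega
    have hd1 : Disjoint (Finset.range a) (Finset.Ico (n - b) n) := by
      rw [Finset.disjoint_left]
      intro i
      simp only [Finset.mem_range, Finset.mem_Ico]
      omega
    have hd2 : Disjoint (Finset.range a ∪ Finset.Ico (n - b) n) ((Finset.Ico a (n - b)).erase j) := by
      rw [Finset.disjoint_left]
      intro i
      simp only [Finset.mem_union, Finset.mem_erase, Finset.mem_range, Finset.mem_Ico]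
      omega
    have hne : ∀ t < n, t ≠ j → y j - y t ≠ 0 := fun t ht htj => sub_ne_zero.2 fun h0 =>
      htj (hy (by simpa using ht) (by simp; omega) h0.symm)
    have h1 : (∏ i ∈ Finset.range a, (y i - y j)⁻¹) * ∏ i ∈ Finset.range a, (y j - y i) =
        (-1) ^ a := by
      rw [← Finset.prod_mul_distrib, Finset.prod_congr rfl fun i hi => ?_, Finset.prod_const,
        Finset.card_range]
      rw [Finset.mem_range] at hi
      have := hne i (by omega) (by omega)
      rw [← neg_sub (y j) (y i), inv_neg, neg_mul, inv_mul_cancel₀ this]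
    have h2 : (∏ i ∈ Finset.Ico (n - b) n, (y i - y j)⁻¹) *
        ∏ i ∈ Finset.Ico (n - b) n, (y j - y i) = (-1) ^ b := by
      rw [← Finset.prod_mul_distrib, Finset.prod_congr rfl fun i hi => ?_, Finset.prod_const,
        Nat.card_Ico, show n - (n - b) = b by omega]
      rw [Finset.mem_Ico] at hi
      have := hne i (by omega) (by omega)
      rw [← neg_sub (y j) (y i), inv_neg, neg_mul, inv_mul_cancel₀ this]
    rw [hset, Finset.prod_union hd2, Finset.prod_union hd1, ← h1, ← h2]
    ring
  · intro j hj hj'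
    rw [Finset.mem_range] at hj
    rw [Finset.mem_Ico] at hj'
    by_cases hja : j < a
    · rw [Finset.prod_eq_zero (i := j) (Finset.mem_range.2 hja) (sub_self _)]
      ring
    · rw [Finset.prod_eq_zero (i := j) (s := Finset.Ico (n - b) n)
        (Finset.mem_Ico.2 ⟨by omega, hj⟩) (sub_self _)]
      ring

theorem det_sign_mul {k : ℕ} (M : Matrix (Fin k) (Fin k) ℚ) :
    (Matrix.of fun a b : Fin k => (-1) ^ (a : ℕ) * (-1) ^ (b : ℕ) * M a b).det = M.det := by
  have h1 := Matrix.det_mul_column (fun a : Fin k => (-1 : ℚ) ^ (a : ℕ))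
    (Matrix.of fun a b => (-1) ^ (b : ℕ) * M a b)
  have h2 := Matrix.det_mul_row (fun b : Fin k => (-1 : ℚ) ^ (b : ℕ)) M
  rw [h2, ← mul_assoc, ← Finset.prod_mul_distrib] at h1
  simp only [Matrix.of_apply, ← mul_assoc] at h1
  rw [h1, Finset.prod_eq_one, one_mul]
  intro a _
  rw [← mul_pow]
  simp

/-- The freedom in the monic polynomials is used to remove nodes from the left in rows and from the
right in columns. The bound on `k` keeps every interval nonempty. -/
theorem subsetSum_range_eq_det {k n : ℕ} (hk : 2 * k ≤ n + 1) (h y : ℕ → ℚ)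
    (hy : Set.InjOn y (Finset.range n)) :
    subsetSum h y k (Finset.range n) = reversalSign k *
      (Matrix.of fun a b : Fin k => nodeSum h y (Finset.Ico a (n - b))).det := by
  rw [subsetSum_eq_det h y _ hy
    (fun a => ∏ t ∈ Finset.range a, (Polynomial.X - Polynomial.C (y t)))
    (fun b => ∏ t ∈ Finset.Ico (n - b) n, (Polynomial.X - Polynomial.C (y t)))
    (fun a => by rw [natDegree_prod_X_sub_C, Finset.card_range])
    (fun a => Polynomial.monic_prod_of_monic _ _ fun t _ => Polynomial.monic_X_sub_C _)
    (fun b => by rw [natDegree_prod_X_sub_C, Nat.card_Ico]; omega)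
    (fun b => Polynomial.monic_prod_of_monic _ _ fun t _ => Polynomial.monic_X_sub_C _),
    ← det_sign_mul (Matrix.of fun a b : Fin k => nodeSum h y (Finset.Ico a (n - b)))]
  congr 3
  ext a b
  rw [nodeSum_mul_eval hy (by omega), Matrix.of_apply]

/-! ### Hankel determinants and divided differences in closed form -/

/-- The determinant of a Hankel matrix with hypergeometric entries. -/
theorem exists_det_hankel_eq (κ : ℕ → ℚ) (σ : ℕ) (hσ : 1 ≤ σ)
    (hκ : ∀ q, κ (q + 1) * (q + σ) = κ q * (4 * q + 2)) (k : ℕ) :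
    ∃ C : ℚ, ∀ e, 2 * k ≤ e + 2 →
      (Matrix.of fun a b : Fin k => κ (e - a - b)).det =
        C * ∏ b ∈ Finset.range k,
          (κ (e + 1 - k - b) / ∏ i ∈ Finset.range (k - 1), ((e + 1 - k - b + i + σ : ℕ) : ℚ)) := by
  -- With `q = e + 1 - k - b`, the recursion carries `κ q` to `κ (q + (k - 1 - a))`, the entry at
  -- `(a, b)`. Clearing all `k - 1` possible denominators `q + i + σ` leaves `κ q` times the value
  -- of `P a` at `q`.
  let P : Fin k → Polynomial ℚ := fun a =>
    (∏ i ∈ Finset.range (k - 1 - a), (Polynomial.C 4 * Polynomial.X + Polynomial.C (4 * i + 2 : ℚ))) *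
      ∏ i ∈ Finset.Ico (k - 1 - a) (k - 1), (Polynomial.X + Polynomial.C (i + σ : ℚ))
  have hκ' : ∀ q t, κ (q + t) * ∏ i ∈ Finset.range t, ((q + i + σ : ℕ) : ℚ) =
      κ q * ∏ i ∈ Finset.range t, (4 * (q : ℚ) + (4 * i + 2)) := by
    intro q t
    induction t with
    | zero => simp
    | succ t ih =>
      rw [Finset.prod_range_succ, Finset.prod_range_succ, ← mul_assoc (κ q), ← ih]
      have := hκ (q + t)
      rw [← add_assoc]
      push_cast at this ⊢
      linear_combination (∏ i ∈ Finset.range t, ((q : ℚ) + i + σ)) * this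
  have hdeg : ∀ a, (P a).natDegree < k := by
    intro a
    have h1 : (∏ i ∈ Finset.range (k - 1 - a),
        (Polynomial.C 4 * Polynomial.X + Polynomial.C (4 * i + 2 : ℚ))).natDegree ≤ k - 1 - a := by
      refine (Polynomial.natDegree_prod_le _ _).trans ?_
      refine (Finset.sum_le_card_nsmul _ _ 1 fun i _ => ?_).trans (by simp)
      exact Polynomial.natDegree_linear_le
    have h2 : (∏ i ∈ Finset.Ico (k - 1 - a) (k - 1),
        (Polynomial.X + Polynomial.C (i + σ : ℚ))).natDegree ≤ (a : ℕ) := by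
      refine (Polynomial.natDegree_prod_le _ _).trans ?_
      refine (Finset.sum_le_card_nsmul _ _ 1 fun i _ => ?_).trans (by simp; omega)
      rw [Polynomial.natDegree_X_add_C]
    have h3 := Polynomial.natDegree_mul_le (p := ∏ i ∈ Finset.range (k - 1 - a),
      (Polynomial.C 4 * Polynomial.X + Polynomial.C (4 * i + 2 : ℚ)))
      (q := ∏ i ∈ Finset.Ico (k - 1 - a) (k - 1), (Polynomial.X + Polynomial.C (i + σ : ℚ)))
    have h4 := a.2
    show (_ * _ : Polynomial ℚ).natDegree < k
    omega
  -- The parameter `e` only translates the nodes `e + 1 - k - b`, so their Vandermonde determinant,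
  -- and hence `C`, does not depend on it.
  refine ⟨(Matrix.of fun a b : Fin k => (P a).coeff b).det *
    ∏ i : Fin k, ∏ j ∈ Finset.Ioi i, ((i : ℚ) - j), fun e he => ?_⟩
  let v : Fin k → ℚ := fun b => ((e + 1 - k - b : ℕ) : ℚ)
  have hvand : (Matrix.vandermonde v).det = ∏ i : Fin k, ∏ j ∈ Finset.Ioi i, ((i : ℚ) - j) := by
    rw [Matrix.det_vandermonde]
    refine Finset.prod_congr rfl fun i _ => Finset.prod_congr rfl fun j _ => ?_
    have h1 := i.2
    have h2 := j.2
    simp only [v]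
    rw [Nat.cast_sub (show (j : ℕ) ≤ e + 1 - k by omega),
      Nat.cast_sub (show (i : ℕ) ≤ e + 1 - k by omega)]
    ring
  have hmul : (Matrix.of fun a b : Fin k => (P a).eval (v b)) =
      (Matrix.of fun a b : Fin k => (P a).coeff b) * (Matrix.vandermonde v).transpose := by
    ext a b
    rw [Matrix.of_apply, Matrix.mul_apply, Polynomial.eval_eq_sum_range' (hdeg a),
      ← Fin.sum_univ_eq_sum_range fun i => (P a).coeff i * v b ^ i]
    rfl
  have hentry : (Matrix.of fun a b : Fin k => κ (e - a - b)) = Matrix.of fun a b : Fin k =>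
      (κ (e + 1 - k - b) / ∏ i ∈ Finset.range (k - 1), ((e + 1 - k - b + i + σ : ℕ) : ℚ)) *
        (Matrix.of fun a b : Fin k => (P a).eval (v b)) a b := by
    ext a b
    have ha := a.2
    have hb := b.2
    have hpos : ∏ i ∈ Finset.range (k - 1), ((e + 1 - k - b + i + σ : ℕ) : ℚ) ≠ 0 :=
      Finset.prod_ne_zero_iff.2 fun i _ => by
        rw [Nat.cast_ne_zero]
        omega
    have hsplit := Finset.prod_range_mul_prod_Ico
      (fun i => ((e + 1 - k - b + i + σ : ℕ) : ℚ)) (show k - 1 - a ≤ k - 1 by omega)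
    have h1 := hκ' (e + 1 - k - b) (k - 1 - a)
    rw [show e + 1 - k - b + (k - 1 - a) = e - a - b by omega] at h1
    rw [Matrix.of_apply, Matrix.of_apply, Matrix.of_apply, div_mul_eq_mul_div, eq_div_iff hpos,
      ← hsplit, ← mul_assoc, h1]
    simp only [P, v, Polynomial.eval_mul, Polynomial.eval_prod, Polynomial.eval_add,
      Polynomial.eval_X, Polynomial.eval_C]
    rw [mul_assoc]
    congr 2
    refine Finset.prod_congr rfl fun i _ => ?_
    push_cast
    ring
  rw [hentry, Matrix.det_mul_row, hmul, Matrix.det_mul, Matrix.det_transpose, hvand,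
    Fin.prod_univ_eq_prod_range (fun b => κ (e + 1 - k - b) /
      ∏ i ∈ Finset.range (k - 1), ((e + 1 - k - b + i + σ : ℕ) : ℚ)) k, mul_comm]

theorem nodeSum_erase {h y : ℕ → ℚ} {A : Finset ℕ} (hy : Set.InjOn y A) {v : ℕ} (hv : v ∈ A) :
    nodeSum h y (A.erase v) =
      ∑ j ∈ A, h j * (∏ i ∈ A.erase j, (y i - y j)⁻¹) * (y v - y j) := by
  rw [nodeSum, ← Finset.add_sum_erase A _ hv, sub_self, mul_zero, zero_add]
  refine Finset.sum_congr rfl fun j hj => ?_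
  obtain ⟨hjv, hjA⟩ := Finset.mem_erase.1 hj
  have hne : y v - y j ≠ 0 := sub_ne_zero.2 fun h => hjv (hy hv hjA h).symm
  rw [← Finset.mul_prod_erase (A.erase j) _ (Finset.mem_erase.2 ⟨hjv.symm, hv⟩),
    Finset.erase_right_comm]
  field_simp

/-- The recursion of divided differences: by `nodeSum_erase`, deleting a node multiplies each term
by a difference of nodes, and the two differences subtract to `y v - y w`. -/
theorem sub_mul_nodeSum {h y : ℕ → ℚ} {A : Finset ℕ} (hy : Set.InjOn y A) {v w : ℕ}
    (hv : v ∈ A) (hw : w ∈ A) :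
    (y v - y w) * nodeSum h y A = nodeSum h y (A.erase v) - nodeSum h y (A.erase w) := by
  rw [nodeSum_erase hy hv, nodeSum_erase hy hw, nodeSum, Finset.mul_sum, ← Finset.sum_sub_distrib]
  exact Finset.sum_congr rfl fun j _ => by ring

theorem injOn_sq_sub {u : ℚ} {n : ℕ} (hu : (n : ℚ) ≤ u) {A : Finset ℕ} (hA : ∀ j ∈ A, j < n) :
    Set.InjOn (fun j : ℕ => (u - j) ^ 2) A := by
  intro i hi j hj h
  have h1 : (i : ℚ) < n := by exact_mod_cast hA i hi
  have h2 : (j : ℚ) < n := by exact_mod_cast hA j hj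
  have h3 := (pow_left_inj₀ (by linarith) (by linarith) two_ne_zero).1 h
  have h4 : (i : ℚ) = j := by linarith
  exact_mod_cast h4

theorem sub_mul_nodeSum_Ico {h : ℕ → ℚ} {u : ℚ} {a q : ℕ} (hu : (a : ℚ) + q + 1 ≤ u) :
    ((u - a) ^ 2 - (u - (a + q)) ^ 2) *
        nodeSum h (fun j => (u - j) ^ 2) (Finset.Ico a (a + q + 1)) =
      nodeSum h (fun j => (u - j) ^ 2) (Finset.Ico (a + 1) (a + q + 1)) -
        nodeSum h (fun j => (u - j) ^ 2) (Finset.Ico a (a + q)) := by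
  have h1 : (Finset.Ico a (a + q + 1)).erase a = Finset.Ico (a + 1) (a + q + 1) := by
    ext i
    simp only [Finset.mem_erase, Finset.mem_Ico]
    omega
  have h2 : (Finset.Ico a (a + q + 1)).erase (a + q) = Finset.Ico a (a + q) := by
    ext i
    simp only [Finset.mem_erase, Finset.mem_Ico]
    omega
  rw [← h1, ← h2, ← sub_mul_nodeSum (injOn_sq_sub (n := a + q + 1) (by push_cast; exact hu)
    fun j hj => (Finset.mem_Ico.1 hj).2) (by simp) (by simp)]
  push_cast
  rfl

/-- Induction on the number of nodes: dropping the first node keeps the gap `c`, dropping the last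
one raises it by one. The factor depending on `q` alone is twice a central binomial coefficient. -/
theorem nodeSum_inv {u : ℚ} {a q c : ℕ} (hu : u = a + q + 1 + c) :
    nodeSum (fun j => (u - j)⁻¹) (fun j => (u - j) ^ 2) (Finset.Ico a (a + q + 1)) =
      2 * (2 * q).factorial / (q.factorial : ℚ) ^ 2 *
        ((2 * c + 1).factorial / (2 * c + 2 * q + 2).factorial) := by
  induction q generalizing a c with
  | zero =>
    have h1 : (2 * c + 1).factorial ≠ 0 := Nat.factorial_ne_zero _
    rw [Nat.mul_zero, Nat.add_zero, Nat.add_zero, Nat.factorial_succ (2 * c + 1)]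
    have h2 : u - a = c + 1 := by rw [hu]; push_cast; ring
    simp [nodeSum, h2]
    field_simp
    ring
  | succ q ih =>
    have h1 := sub_mul_nodeSum_Ico (h := fun j => (u - j)⁻¹) (u := u) (a := a) (q := q + 1)
      (by rw [hu]; push_cast; linarith [(Nat.cast_nonneg c : (0 : ℚ) ≤ c)])
    have h2 := ih (a := a + 1) (c := c) (by rw [hu]; push_cast; ring)
    have h3 := ih (a := a) (c := c + 1) (by rw [hu]; push_cast; ring)
    rw [show a + 1 + q + 1 = a + (q + 1) + 1 by ring] at h2
    rw [← add_assoc a q 1, h3, add_assoc a q 1, h2] at h1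
    have h4 : (u - a) ^ 2 - (u - (a + (q + 1 : ℕ))) ^ 2 = (q + 1) * (2 * c + q + 3) := by
      rw [hu]; push_cast; ring
    rw [h4] at h1
    have h5 : ((q : ℚ) + 1) * (2 * c + q + 3) ≠ 0 := by positivity
    apply mul_left_cancel₀ h5
    rw [h1, show 2 * (c + 1) + 1 = 2 * c + 1 + 1 + 1 by ring,
      show 2 * (c + 1) + 2 * q + 2 = 2 * c + 2 * q + 2 + 1 + 1 by ring,
      show 2 * c + 2 * (q + 1) + 2 = 2 * c + 2 * q + 2 + 1 + 1 by ring,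
      show 2 * (q + 1) = 2 * q + 1 + 1 by ring]
    simp only [Nat.factorial_succ (_ + 1), Nat.factorial_succ (2 * q), Nat.factorial_succ q]
    have h6 : ((2 * c + 1).factorial : ℚ) ≠ 0 := by positivity
    have h7 : ((2 * c + 2 * q + 2).factorial : ℚ) ≠ 0 := by positivity
    have h8 : (q.factorial : ℚ) ≠ 0 := by positivity
    have h9 : ((2 * q).factorial : ℚ) ≠ 0 := by positivity
    push_cast
    field_simp
    ring

/-- The same recursion, started at two nodes because a single node does not fit the formula; here
the factor in `q` is minus a Catalan number. -/
theorem nodeSum_self {u : ℚ} {a q c : ℕ} (hu : u = a + q + 2 + c) :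
    nodeSum (fun j => u - j) (fun j => (u - j) ^ 2) (Finset.Ico a (a + q + 2)) =
      -((2 * q).factorial / ((q + 1).factorial * q.factorial) : ℚ) *
        ((2 * c + 2).factorial / (2 * c + 2 * q + 3).factorial) := by
  induction q generalizing a c with
  | zero =>
    have h1 : ((2 * c + 2).factorial : ℚ) ≠ 0 := by positivity
    have h2 : u - a = c + 2 := by rw [hu]; push_cast; ring
    have h3 : u - (a + 1) = c + 1 := by rw [hu]; push_cast; ring
    have h4 : Finset.Ico a (a + 0 + 2) = {a, a + 1} := by
      ext i
      simp only [Finset.mem_Ico, Finset.mem_insert, Finset.mem_singleton]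
      omega
    have h5 : ({a, a + 1} : Finset ℕ).erase a = {a + 1} := by
      ext i
      simp only [Finset.mem_erase, Finset.mem_insert, Finset.mem_singleton]
      omega
    have h6 : ({a, a + 1} : Finset ℕ).erase (a + 1) = {a} := by
      ext i
      simp only [Finset.mem_erase, Finset.mem_insert, Finset.mem_singleton]
      omega
    have h7 : ((c : ℚ) + 1) ^ 2 - (c + 2) ^ 2 = -(2 * c + 3) := by ring
    have h8 : ((c : ℚ) + 2) ^ 2 - (c + 1) ^ 2 = 2 * c + 3 := by ring
    have h9 : (2 * (c : ℚ) + 3) ≠ 0 := by positivity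
    rw [h4, nodeSum, Finset.sum_pair (by omega), h5, h6, Finset.prod_singleton,
      Finset.prod_singleton, Nat.cast_add_one, h2, h3, h7, h8, inv_neg, Nat.mul_zero, Nat.add_zero,
      Nat.factorial_succ (2 * c + 2)]
    simp
    field_simp
    ring
  | succ q ih =>
    have h1 := sub_mul_nodeSum_Ico (h := fun j => u - j) (u := u) (a := a) (q := q + 2)
      (by rw [hu]; push_cast; linarith [(Nat.cast_nonneg c : (0 : ℚ) ≤ c)])
    have h2 := ih (a := a + 1) (c := c) (by rw [hu]; push_cast; ring)
    have h3 := ih (a := a) (c := c + 1) (by rw [hu]; push_cast; ring)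
    rw [show a + 1 + q + 2 = a + (q + 2) + 1 by ring] at h2
    rw [← add_assoc a q 2, h3, add_assoc a q 2, h2] at h1
    have h4 : (u - a) ^ 2 - (u - (a + (q + 2 : ℕ))) ^ 2 = (q + 2) * (2 * c + q + 4) := by
      rw [hu]; push_cast; ring
    rw [h4] at h1
    have h5 : ((q : ℚ) + 2) * (2 * c + q + 4) ≠ 0 := by positivity
    apply mul_left_cancel₀ h5
    rw [show a + (q + 1) + 2 = a + (q + 2) + 1 by ring, h1,
      show 2 * (c + 1) + 2 = 2 * c + 2 + 1 + 1 by ring,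
      show 2 * (c + 1) + 2 * q + 3 = 2 * c + 2 * q + 3 + 1 + 1 by ring,
      show 2 * c + 2 * (q + 1) + 3 = 2 * c + 2 * q + 3 + 1 + 1 by ring,
      show 2 * (q + 1) = 2 * q + 1 + 1 by ring]
    simp only [Nat.factorial_succ (_ + 1), Nat.factorial_succ (2 * q), Nat.factorial_succ q]
    have h6 : ((2 * c + 2).factorial : ℚ) ≠ 0 := by positivity
    have h7 : ((2 * c + 2 * q + 3).factorial : ℚ) ≠ 0 := by positivity
    have h8 : (q.factorial : ℚ) ≠ 0 := by positivity
    have h9 : ((2 * q).factorial : ℚ) ≠ 0 := by positivity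
    push_cast
    field_simp
    ring

theorem det_of_mul_mul {k : ℕ} (f g : ℕ → ℚ) (M : Matrix (Fin k) (Fin k) ℚ) :
    (Matrix.of fun a b : Fin k => f b * (g a * M a b)).det =
      (∏ b ∈ Finset.range k, f b) * ((∏ a ∈ Finset.range k, g a) * M.det) := by
  rw [← Fin.prod_univ_eq_prod_range f, ← Fin.prod_univ_eq_prod_range g,
    ← Matrix.det_mul_column, ← Matrix.det_mul_row]
  rfl

theorem prod_range_add_factorial (q σ t : ℕ) :
    ∏ i ∈ Finset.range t, ((q + i + (σ + 1) : ℕ) : ℚ) =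
      (q + σ + t).factorial / (q + σ).factorial := by
  have h : ((q + σ).factorial : ℚ) ≠ 0 := by positivity
  rw [eq_div_iff h]
  induction t with
  | zero => simp
  | succ t ih =>
    rw [Finset.prod_range_succ, mul_right_comm, ih, ← add_assoc (q + σ) t 1, Nat.factorial_succ]
    push_cast
    ring

/-- In the entry at `(a, b)` the gap is `c + b` and `q = n - 1 - a - b`, so one factorial depends on
`b` only and the other on `a` only. The rest is a Hankel matrix, and `C` depends on `k` alone. -/
theorem exists_subsetSum_inv_eq (k : ℕ) : ∃ C : ℚ, ∀ n c : ℕ, 2 * k ≤ n + 1 → ∀ u : ℚ,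
    u = c + n → subsetSum (fun j => (u - j)⁻¹) (fun j => (u - j) ^ 2) k (Finset.range n) =
      C * (∏ b ∈ Finset.range k, ((2 * c + 2 * b + 1).factorial : ℚ)) *
        (∏ a ∈ Finset.range k, ((2 * c + 2 * n - 2 * a).factorial : ℚ)⁻¹) *
        ∏ b ∈ Finset.range k, ((2 * (n - k - b)).factorial /
          ((n - k - b).factorial * (n - k - b + (k - 1)).factorial) : ℚ) := by
  obtain ⟨C, hC⟩ := exists_det_hankel_eq
    (fun q => 2 * (2 * q).factorial / (q.factorial : ℚ) ^ 2) 1 le_rfl (fun q => by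
      rw [show 2 * (q + 1) = 2 * q + 1 + 1 by ring]
      simp only [Nat.factorial_succ]
      have h8 : (q.factorial : ℚ) ≠ 0 := by positivity
      push_cast
      field_simp
      ring) k
  refine ⟨reversalSign k * C * 2 ^ k, fun n c hk u hu => ?_⟩
  rw [subsetSum_range_eq_det hk _ _ (injOn_sq_sub (n := n)
    (by rw [hu]; linarith [(Nat.cast_nonneg c : (0 : ℚ) ≤ c)]) fun j hj => Finset.mem_range.1 hj)]
  have hmat : (Matrix.of fun a b : Fin k => nodeSum (fun j => (u - j)⁻¹) (fun j => (u - j) ^ 2)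
      (Finset.Ico (a : ℕ) (n - b))) = Matrix.of fun a b : Fin k =>
        ((2 * c + 2 * b + 1).factorial : ℚ) * (((2 * c + 2 * n - 2 * a).factorial : ℚ)⁻¹ *
          (Matrix.of fun a b : Fin k =>
            2 * (2 * (n - 1 - a - b)).factorial / ((n - 1 - a - b).factorial : ℚ) ^ 2) a b) := by
    ext a b
    have ha := a.2
    have hb := b.2
    obtain ⟨q, hq⟩ : ∃ q, n = a + b + q + 1 := ⟨n - 1 - a - b, by omega⟩
    have h1 := nodeSum_inv (u := u) (a := a) (q := q) (c := c + b)
      (by rw [hu, hq]; push_cast; ring)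
    rw [Matrix.of_apply, Matrix.of_apply, Matrix.of_apply,
      show n - (b : ℕ) = a + q + 1 by omega, h1, show n - 1 - (a : ℕ) - b = q by omega,
      show 2 * (c + (b : ℕ)) + 1 = 2 * c + 2 * b + 1 by ring,
      show 2 * (c + (b : ℕ)) + 2 * q + 2 = 2 * c + 2 * n - 2 * a by omega]
    field_simp
  rw [hmat, det_of_mul_mul (fun b => ((2 * c + 2 * b + 1).factorial : ℚ))
    fun a => ((2 * c + 2 * n - 2 * a).factorial : ℚ)⁻¹, hC (n - 1) (by omega)]
  have hprod : ∏ b ∈ Finset.range k,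
      ((2 * (2 * (n - 1 + 1 - k - b)).factorial / ((n - 1 + 1 - k - b).factorial : ℚ) ^ 2) /
        ∏ i ∈ Finset.range (k - 1), ((n - 1 + 1 - k - b + i + 1 : ℕ) : ℚ)) =
      2 ^ k * ∏ b ∈ Finset.range k, ((2 * (n - k - b)).factorial /
          ((n - k - b).factorial * (n - k - b + (k - 1)).factorial) : ℚ) := by
    rw [← Finset.card_range k, ← Finset.prod_const, Finset.card_range, ← Finset.prod_mul_distrib]
    refine Finset.prod_congr rfl fun b hb => ?_
    rw [Finset.mem_range] at hb
    rw [show n - 1 + 1 - k - b = n - k - b by omega, prod_range_add_factorial _ 0, add_zero]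
    field_simp
  rw [hprod]
  ring

/-- As before, with Catalan numbers, whose recursion has shift `σ = 2`. -/
theorem exists_subsetSum_self_eq (k : ℕ) : ∃ C : ℚ, ∀ n c : ℕ, 2 * k ≤ n → ∀ u : ℚ,
    u = c + n → subsetSum (fun j => u - j) (fun j => (u - j) ^ 2) k (Finset.range n) =
      C * (∏ b ∈ Finset.range k, ((2 * c + 2 * b + 2).factorial : ℚ)) *
        (∏ a ∈ Finset.range k, ((2 * c + 2 * n - 2 * a - 1).factorial : ℚ)⁻¹) *
        ∏ b ∈ Finset.range k, ((2 * (n - 1 - k - b)).factorial /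
          ((n - 1 - k - b).factorial * (n - k - b + (k - 1)).factorial) : ℚ) := by
  obtain ⟨C, hC⟩ := exists_det_hankel_eq
    (fun q => -((2 * q).factorial / ((q + 1).factorial * q.factorial) : ℚ)) 2 one_le_two
    (fun q => by
      rw [show 2 * (q + 1) = 2 * q + 1 + 1 by ring]
      simp only [Nat.factorial_succ]
      have h8 : (q.factorial : ℚ) ≠ 0 := by positivity
      push_cast
      field_simp
      ring) k
  refine ⟨reversalSign k * C * (-1) ^ k, fun n c hk u hu => ?_⟩
  rw [subsetSum_range_eq_det (by omega) _ _ (injOn_sq_sub (n := n)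
    (by rw [hu]; linarith [(Nat.cast_nonneg c : (0 : ℚ) ≤ c)]) fun j hj => Finset.mem_range.1 hj)]
  have hmat : (Matrix.of fun a b : Fin k => nodeSum (fun j => u - j) (fun j => (u - j) ^ 2)
      (Finset.Ico (a : ℕ) (n - b))) = Matrix.of fun a b : Fin k =>
        ((2 * c + 2 * b + 2).factorial : ℚ) * (((2 * c + 2 * n - 2 * a - 1).factorial : ℚ)⁻¹ *
          (Matrix.of fun a b : Fin k => -((2 * (n - 2 - a - b)).factorial /
            ((n - 2 - a - b + 1).factorial * (n - 2 - a - b).factorial) : ℚ)) a b) := by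
    ext a b
    have ha := a.2
    have hb := b.2
    obtain ⟨q, hq⟩ : ∃ q, n = a + b + q + 2 := ⟨n - 2 - a - b, by omega⟩
    have h1 := nodeSum_self (u := u) (a := a) (q := q) (c := c + b)
      (by rw [hu, hq]; push_cast; ring)
    rw [Matrix.of_apply, Matrix.of_apply, Matrix.of_apply,
      show n - (b : ℕ) = a + q + 2 by omega, h1, show n - 2 - (a : ℕ) - b = q by omega,
      show 2 * (c + (b : ℕ)) + 2 = 2 * c + 2 * b + 2 by ring,
      show 2 * (c + (b : ℕ)) + 2 * q + 3 = 2 * c + 2 * n - 2 * a - 1 by omega]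
    ring
  rw [hmat, det_of_mul_mul (fun b => ((2 * c + 2 * b + 2).factorial : ℚ))
    fun a => ((2 * c + 2 * n - 2 * a - 1).factorial : ℚ)⁻¹, hC (n - 2) (by omega)]
  have hprod : ∏ b ∈ Finset.range k,
      (-((2 * (n - 2 + 1 - k - b)).factorial /
            ((n - 2 + 1 - k - b + 1).factorial * (n - 2 + 1 - k - b).factorial) : ℚ) /
        ∏ i ∈ Finset.range (k - 1), ((n - 2 + 1 - k - b + i + 2 : ℕ) : ℚ)) =
      (-1) ^ k * ∏ b ∈ Finset.range k, ((2 * (n - 1 - k - b)).factorial /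
          ((n - 1 - k - b).factorial * (n - k - b + (k - 1)).factorial) : ℚ) := by
    rw [← Finset.card_range k, ← Finset.prod_const, Finset.card_range, ← Finset.prod_mul_distrib]
    refine Finset.prod_congr rfl fun b hb => ?_
    rw [Finset.mem_range] at hb
    rw [show n - 2 + 1 - k - b = n - 1 - k - b by omega, prod_range_add_factorial _ 1,
      show n - 1 - k - b + 1 = n - k - b by omega]
    field_simp
  rw [hprod]
  ring

/-! ### The subset sum on an arithmetic progression -/

theorem prod_pairs_mul_swap (n : ℕ) (f : ℕ → ℕ → ℚ) (hf : ∀ a, f a a = 1) :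
    ∏ b ∈ Finset.range n, ∏ a ∈ Finset.range b, (f a b * f b a) =
      ∏ j ∈ Finset.range n, ∏ i ∈ Finset.range n, f i j := by
  induction n with
  | zero => simp
  | succ n ih =>
    have h : ∀ j, ∏ i ∈ Finset.range (n + 1), f i j = (∏ i ∈ Finset.range n, f i j) * f n j :=
      fun j => Finset.prod_range_succ _ _
    rw [Finset.prod_range_succ, ih, Finset.prod_range_succ, h n, hf, mul_one,
      Finset.prod_congr rfl fun j _ => h j, Finset.prod_mul_distrib, Finset.prod_mul_distrib]
    ring

/-- For a pair split by `J`, `± 1 / (x a + x b)` is `x a - x b` times the inverse difference of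
squares, taken with the index outside `J` first. The Vandermonde product thus leaves the sum over
`J`. -/
theorem pairProduct_eq_mul {n : ℕ} {J : Finset ℕ} (hJ : J ⊆ Finset.range n) {x : ℕ → ℚ}
    (hx : Set.InjOn (fun i => x i ^ 2) (Finset.range n)) :
    pairProduct n J x = (∏ b ∈ Finset.range n, ∏ a ∈ Finset.range b, (x a - x b)) *
      ∏ j ∈ J, ∏ i ∈ Finset.range n \ J, (x i ^ 2 - x j ^ 2)⁻¹ := by
  let φ : ℕ → ℕ → ℚ := fun i j => if i ∉ J ∧ j ∈ J then (x i ^ 2 - x j ^ 2)⁻¹ else 1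
  have hφ : ∏ j ∈ Finset.range n, ∏ i ∈ Finset.range n, φ i j =
      ∏ j ∈ J, ∏ i ∈ Finset.range n \ J, (x i ^ 2 - x j ^ 2)⁻¹ := by
    rw [← Finset.prod_subset hJ]
    · refine Finset.prod_congr rfl fun j hj => ?_
      rw [Finset.sdiff_eq_filter, Finset.prod_filter]
      simp [φ, hj]
    · intro j _ hj
      simp [φ, hj]
  rw [← hφ, ← prod_pairs_mul_swap n φ (fun a => if_neg fun h => h.1 h.2), pairProduct,
    ← Finset.prod_mul_distrib]
  refine Finset.prod_congr rfl fun b hb => ?_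
  rw [← Finset.prod_mul_distrib]
  refine Finset.prod_congr rfl fun a ha => ?_
  rw [Finset.mem_range] at ha hb
  have hne : x a ^ 2 ≠ x b ^ 2 := fun h =>
    ha.ne (hx (by simp; omega) (by simp; omega) h)
  have h1 : x a - x b ≠ 0 := fun h => hne (by rw [sub_eq_zero.1 h])
  have h2 : x a + x b ≠ 0 := fun h => hne (by
    rw [eq_neg_of_add_eq_zero_left h, neg_sq])
  have h3 : (x a ^ 2 - x b ^ 2) = (x a - x b) * (x a + x b) := by ring
  have h4 : (x b ^ 2 - x a ^ 2) = -((x a - x b) * (x a + x b)) := by ring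
  by_cases h5 : a ∈ J <;> by_cases h6 : b ∈ J <;> simp only [pairFactor, φ, h5, h6, not_true,
    not_false_iff, and_true, and_false, if_true, if_false, iff_true,
    iff_false, mul_one, one_mul, h3, h4]
  · field_simp
  · field_simp

theorem tableauSum_congr {r n : ℕ} {x y : ℕ → ℚ} (h : ∀ i < n, x i = y i) :
    tableauSum r n x = tableauSum r n y := by
  unfold tableauSum
  congr 1
  refine Finset.sum_congr rfl fun J hJ => ?_
  have hJ := (Finset.mem_powersetCard.1 hJ).1
  have hlin : linearIndices r n J ⊆ Finset.range n := by
    unfold linearIndices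
    split_ifs
    · exact Finset.sdiff_subset
    · exact hJ
  unfold tableauTerm pairProduct
  congr 1
  · exact Finset.prod_congr rfl fun i hi => h i (Finset.mem_range.1 (hlin hi))
  · refine Finset.prod_congr rfl fun b hb => Finset.prod_congr rfl fun a ha => ?_
    rw [Finset.mem_range] at ha hb
    rw [pairFactor, pairFactor, h a (by omega), h b hb]

theorem prod_pairs_sub (u : ℚ) (n : ℕ) :
    ∏ b ∈ Finset.range n, ∏ a ∈ Finset.range b, ((u - a) - (u - b)) =
      ∏ b ∈ Finset.range n, (b.factorial : ℚ) := by
  refine Finset.prod_congr rfl fun b _ => ?_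
  rw [← prod_range_natCast_sub]
  exact Finset.prod_congr rfl fun a _ => by ring

/-- The linear factors over the complement of `J` are the full product divided by those in `J`,
hence the weight `(u - j)⁻¹`; for odd `r` they run over `J` itself and the weight is `u - j`. -/
theorem tableauSum_even {k n : ℕ} {u : ℚ} (hu : (n : ℚ) ≤ u) :
    tableauSum (2 * k) n (fun j => u - j) = (-1) ^ k.choose 2 *
      ((∏ b ∈ Finset.range n, (b.factorial : ℚ)) * (∏ i ∈ Finset.range n, (u - i)) *
        subsetSum (fun j => (u - j)⁻¹) (fun j => (u - j) ^ 2) k (Finset.range n)) := by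
  have hinj := injOn_sq_sub hu fun j (hj : j ∈ Finset.range n) => Finset.mem_range.1 hj
  rw [tableauSum, show (2 * k + 1) / 2 = k by omega, show 2 * k / 2 = k by omega, subsetSum,
    Finset.mul_sum _ _ ((∏ b ∈ Finset.range n, (b.factorial : ℚ)) * ∏ i ∈ Finset.range n, (u - i))]
  congr 1
  refine Finset.sum_congr rfl fun J hJ => ?_
  have hJ := (Finset.mem_powersetCard.1 hJ).1
  have hne : ∏ i ∈ J, (u - i) ≠ 0 := Finset.prod_ne_zero_iff.2 fun i hi => by
    have : (i : ℚ) < n := by exact_mod_cast Finset.mem_range.1 (hJ hi)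
    linarith
  rw [tableauTerm, pairProduct_eq_mul hJ hinj, prod_pairs_sub, linearIndices,
    if_pos (even_two_mul k), ← Finset.prod_sdiff (f := fun i : ℕ => u - (i : ℚ)) hJ, Finset.prod_mul_distrib,
    Finset.prod_inv_distrib]
  field_simp

theorem tableauSum_odd {k n : ℕ} {u : ℚ} (hu : (n : ℚ) ≤ u) :
    tableauSum (2 * k + 1) n (fun j => u - j) = (-1) ^ (k + 1).choose 2 *
      ((∏ b ∈ Finset.range n, (b.factorial : ℚ)) *
        subsetSum (fun j => u - j) (fun j => (u - j) ^ 2) k (Finset.range n)) := by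
  have hinj := injOn_sq_sub hu fun j (hj : j ∈ Finset.range n) => Finset.mem_range.1 hj
  rw [tableauSum, show (2 * k + 1 + 1) / 2 = k + 1 by omega, show (2 * k + 1) / 2 = k by omega,
    subsetSum, Finset.mul_sum _ _ (∏ b ∈ Finset.range n, (b.factorial : ℚ))]
  congr 1
  refine Finset.sum_congr rfl fun J hJ => ?_
  have hJ := (Finset.mem_powersetCard.1 hJ).1
  rw [tableauTerm, pairProduct_eq_mul hJ hinj, prod_pairs_sub, linearIndices,
    if_neg (by simp), Finset.prod_mul_distrib]
  ring

/-! ### Factorial products and `E1` -/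

theorem prod_Ico_natCast_add (u a t : ℕ) :
    ∏ l ∈ Finset.Ico (a + 1) (a + 1 + t), ((l : ℚ) + u) = (u + a + t).factorial / (u + a).factorial := by
  rw [Finset.prod_Ico_eq_prod_range, show a + 1 + t - (a + 1) = t by omega,
    ← prod_range_add_factorial u a t]
  refine Finset.prod_congr rfl fun i _ => ?_
  push_cast
  ring

/-- The even product telescopes into factorials. -/
theorem E1Even_eq_prod {k p s : ℕ} (hk : 2 * k ≤ p) :
    E1Even (2 * k) p s = (∏ t ∈ Finset.range k, ((2 * s + 2 * t + 1).factorial : ℚ)) *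
      ∏ t ∈ Finset.range k, ((2 * s + 2 * p - 2 * t).factorial : ℚ)⁻¹ := by
  induction k with
  | zero => simp [E1Even]
  | succ k ih =>
    rw [Finset.prod_range_succ, Finset.prod_range_succ, mul_mul_mul_comm, ← ih (by omega)]
    -- From `2 * k` to `2 * k + 2`, the outer indices `2 * k + 1`, `2 * k + 2` and their mirror
    -- images under `l ↦ 2 * p + 2 - l` move to the second product. Exactly the indices from `2 * k
    -- + 2` to its mirror image gain one in exponent, which gives a ratio of factorials.
    obtain ⟨e, rfl⟩ : ∃ e, p = 2 * k + 2 + e := ⟨p - (2 * k + 2), by omega⟩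
    have hpos : ∀ l : ℕ, 0 < l → ((l : ℚ) + 2 * s) ≠ 0 := fun l hl => by positivity
    set I := Finset.Ioo (2 * k + 2) (2 * k + 4 + 2 * e) with hI
    have h1 : Finset.Ioo (2 * k) (2 * (2 * k + 2 + e) + 2 - 2 * k) =
        insert (2 * k + 1) (insert (2 * k + 2) (insert (2 * k + 4 + 2 * e)
          (insert (2 * k + 5 + 2 * e) I))) := by
      ext l
      simp only [hI, Finset.mem_insert, Finset.mem_Ioo]
      omega
    have h2 : Finset.Ioo (2 * (k + 1)) (2 * (2 * k + 2 + e) + 2 - 2 * (k + 1)) = I := by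
      ext l
      simp only [hI, Finset.mem_Ioo]
      omega
    have h3 : Finset.Icc 2 (2 * (k + 1)) =
        insert (2 * k + 2) (Finset.Icc 2 (2 * k + 1)) := by
      ext l
      simp only [Finset.mem_insert, Finset.mem_Icc]
      omega
    have h4 : ∏ l ∈ Finset.Icc 2 (2 * k + 1), 1 / (((l : ℚ) + 2 * s) *
          (2 * ((2 * k + 2 + e : ℕ) : ℚ) - l + 2 + 2 * s)) ^ (l / 2) =
        (∏ l ∈ Finset.Icc 2 (2 * k), 1 / (((l : ℚ) + 2 * s) *
          (2 * ((2 * k + 2 + e : ℕ) : ℚ) - l + 2 + 2 * s)) ^ (l / 2)) *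
        (1 / ((((2 * k + 1 : ℕ) : ℚ) + 2 * s) * (((2 * k + 5 + 2 * e : ℕ) : ℚ) + 2 * s)) ^ k) := by
      -- For `k = 0` the index `2 * k + 1` is outside the range, but its exponent is `0`.
      rcases Nat.eq_zero_or_pos k with rfl | hk0
      · simp
      · have h5 : Finset.Icc 2 (2 * k + 1) = insert (2 * k + 1) (Finset.Icc 2 (2 * k)) := by
          ext l
          simp only [Finset.mem_insert, Finset.mem_Icc]
          omega
        rw [h5, Finset.prod_insert (by simp), mul_comm, show (2 * k + 1) / 2 = k by omega]
        congr 4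
        push_cast
        ring
    have h6 : (∏ l ∈ I, ((l : ℚ) + 2 * s)) * (((2 * k + 2 : ℕ) : ℚ) + 2 * s) *
        (((2 * k + 4 + 2 * e : ℕ) : ℚ) + 2 * s) =
        (2 * s + 2 * (2 * k + 2 + e) - 2 * k).factorial / (2 * s + 2 * k + 1).factorial := by
      have h7 := prod_Ico_natCast_add (2 * s) (2 * k + 1) (3 + 2 * e)
      have h8 : Finset.Ico (2 * k + 1 + 1) (2 * k + 1 + 1 + (3 + 2 * e)) =
          insert (2 * k + 2) (insert (2 * k + 4 + 2 * e) I) := by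
        ext l
        simp only [hI, Finset.mem_insert, Finset.mem_Ico, Finset.mem_Ioo]
        omega
      rw [h8, Finset.prod_insert (by simp only [hI, Finset.mem_insert, Finset.mem_Ioo]; omega), Finset.prod_insert (by simp [hI])] at h7
      rw [show 2 * s + 2 * (2 * k + 2 + e) - 2 * k = 2 * s + (2 * k + 1) + (3 + 2 * e) by omega,
        show 2 * s + 2 * k + 1 = 2 * s + (2 * k + 1) by ring, ← h7]
      push_cast
      ring
    have h9 : ((2 * s + 2 * k + 1).factorial : ℚ) *
        ((2 * s + 2 * (2 * k + 2 + e) - 2 * k).factorial : ℚ)⁻¹ =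
        ((∏ l ∈ I, ((l : ℚ) + 2 * s)) * (((2 * k + 2 : ℕ) : ℚ) + 2 * s) *
        (((2 * k + 4 + 2 * e : ℕ) : ℚ) + 2 * s))⁻¹ := by
      rw [h6, inv_div, div_eq_mul_inv]
    have h10 : 2 * ((2 * k + 2 + e : ℕ) : ℚ) - ((2 * k + 2 : ℕ) : ℚ) + 2 + 2 * s =
        ((2 * k + 4 + 2 * e : ℕ) : ℚ) + 2 * s := by
      push_cast
      ring
    rw [h9, E1Even, E1Even, h2, h1, h3, Finset.prod_insert (by simp), h4,
      Finset.prod_insert (by simp only [hI, Finset.mem_insert, Finset.mem_Ioo]; omega),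
      Finset.prod_insert (by simp only [hI, Finset.mem_insert, Finset.mem_Ioo]; omega),
      Finset.prod_insert (by simp only [hI, Finset.mem_insert, Finset.mem_Ioo]; omega),
      Finset.prod_insert (by simp [hI]),
      show 2 * (k + 1) / 2 = k + 1 by omega, show 2 * k / 2 = k by omega,
      show (2 * k + 2) / 2 = k + 1 by omega, h10]
    simp only [one_div, Finset.prod_inv_distrib, Finset.prod_pow]
    have e1 := hpos (2 * k + 1) (by omega)
    have e2 := hpos (2 * k + 2) (by omega)
    have e3 := hpos (2 * k + 4 + 2 * e) (by omega)
    have e4 := hpos (2 * k + 5 + 2 * e) (by omega)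
    generalize ((2 * k + 1 : ℕ) : ℚ) + 2 * s = w1 at e1 ⊢
    generalize ((2 * k + 2 : ℕ) : ℚ) + 2 * s = w2 at e2 ⊢
    generalize ((2 * k + 4 + 2 * e : ℕ) : ℚ) + 2 * s = w3 at e3 ⊢
    generalize ((2 * k + 5 + 2 * e : ℕ) : ℚ) + 2 * s = w4 at e4 ⊢
    generalize ∏ l ∈ I, ((l : ℚ) + 2 * s) = W
    simp only [mul_pow, pow_succ, mul_inv]
    ring

theorem E1_ne_zero {r p s : ℕ} (hr : r ≤ p) : E1 r p s ≠ 0 := by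
  have h : ∀ k, 2 * k ≤ p → E1Even (2 * k) p s ≠ 0 := fun k hk => by
    rw [E1Even_eq_prod hk]
    positivity
  rcases Nat.even_or_odd' r with ⟨k, rfl | rfl⟩
  · rw [E1, if_pos (even_two_mul k)]
    exact h k hr
  · rw [E1, if_neg (by simp), Nat.add_sub_cancel]
    have := h k (by omega)
    positivity

/-- Since `(2t)! = 2t * (2t - 1)!` with `t = M - a`. This converts the odd factorials arising for
odd `r` to those of `E1Even`; `(M - k)!` becomes the denominator in the odd case of `E1`. -/
theorem prod_inv_factorial_eq (M k : ℕ) (hk : k ≤ M) :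
    ∏ a ∈ Finset.range k, ((2 * M - 2 * a - 1).factorial : ℚ)⁻¹ =
      2 ^ k * (M.factorial / (M - k).factorial) *
        ∏ a ∈ Finset.range k, ((2 * M - 2 * a).factorial : ℚ)⁻¹ := by
  induction k with
  | zero => simp [Nat.factorial_ne_zero]
  | succ k ih =>
    rw [Finset.prod_range_succ, ih (by omega), Finset.prod_range_succ]
    obtain ⟨e, rfl⟩ : ∃ e, M = k + 1 + e := ⟨M - (k + 1), by omega⟩
    rw [show 2 * (k + 1 + e) - 2 * k - 1 = 2 * e + 1 by omega,
      show 2 * (k + 1 + e) - 2 * k = 2 * e + 1 + 1 by omega,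
      show k + 1 + e - k = e + 1 by omega, show k + 1 + e - (k + 1) = e by omega,
      Nat.factorial_succ (2 * e + 1), Nat.factorial_succ e]
    have h1 : (e.factorial : ℚ) ≠ 0 := by positivity
    have h2 : ((2 * e + 1).factorial : ℚ) ≠ 0 := by positivity
    push_cast
    field_simp
    ring

/-- The product of the reciprocal hook lengths of an `m × d` rectangle. -/
def rectangleFactor (m d : ℕ) : ℚ :=
  (∏ j ∈ Finset.range d, (j.factorial : ℚ)) / ∏ j ∈ Finset.range d, ((m + j).factorial : ℚ)

/-- After reversing the second product, `(2 * (d + t + 1))!` yields `2 * (d + t + 1) * (2 * d + 2 *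
t + 1)!`, and the other factorials cancel those with `b ≥ d`. -/
theorem prod_factorial_mul_even (d k : ℕ) :
    (∏ b ∈ Finset.range (d + 2 * k), (b.factorial : ℚ)) *
      ∏ b ∈ Finset.range k, ((2 * (d + 2 * k - k - b)).factorial /
        ((d + 2 * k - k - b).factorial * (d + 2 * k - k - b + (k - 1)).factorial) : ℚ) =
    2 ^ k * (∏ b ∈ Finset.range d, (b.factorial : ℚ)) *
      ∏ t ∈ Finset.range k, ((2 * d + 2 * t + 1).factorial : ℚ) := by
  have h : ∏ b ∈ Finset.range k, ((2 * (d + 2 * k - k - b)).factorial /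
        ((d + 2 * k - k - b).factorial * (d + 2 * k - k - b + (k - 1)).factorial) : ℚ) =
      ∏ t ∈ Finset.range k, ((2 * (d + t + 1)).factorial /
        ((d + t + 1).factorial * (d + k + t).factorial) : ℚ) := by
    rw [← Finset.prod_range_reflect]
    refine Finset.prod_congr rfl fun t ht => ?_
    rw [Finset.mem_range] at ht
    rw [show d + 2 * k - k - (k - 1 - t) = d + t + 1 by omega,
      show d + t + 1 + (k - 1) = d + k + t by omega]
  rw [h, Finset.prod_range_add, two_mul k, Finset.prod_range_add]
  have key : (∏ t ∈ Finset.range k, ((d + t).factorial : ℚ)) *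
      (∏ t ∈ Finset.range k, ((d + (k + t)).factorial : ℚ)) *
      ∏ t ∈ Finset.range k, ((2 * (d + t + 1)).factorial /
        ((d + t + 1).factorial * (d + k + t).factorial) : ℚ) =
      2 ^ k * ∏ t ∈ Finset.range k, ((2 * d + 2 * t + 1).factorial : ℚ) := by
    rw [← Finset.prod_mul_distrib, ← Finset.prod_mul_distrib, ← Finset.card_range k,
      ← Finset.prod_const, Finset.card_range, ← Finset.prod_mul_distrib]
    refine Finset.prod_congr rfl fun t _ => ?_
    rw [show 2 * (d + t + 1) = 2 * d + 2 * t + 1 + 1 by ring, Nat.factorial_succ (_ + 1),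
      Nat.factorial_succ (d + t), ← add_assoc d k t]
    have h1 : ((d + t).factorial : ℚ) ≠ 0 := by positivity
    have h2 : ((d + k + t).factorial : ℚ) ≠ 0 := by positivity
    push_cast
    field_simp
    ring
  linear_combination (∏ b ∈ Finset.range d, (b.factorial : ℚ)) * key

/-- The same cancellation leaves one factorial over, `(k + d)!`, the numerator in the odd case of
`E1`. -/
theorem prod_factorial_mul_odd (d k : ℕ) :
    (∏ b ∈ Finset.range (d + (2 * k + 1)), (b.factorial : ℚ)) *
      ∏ b ∈ Finset.range k, ((2 * (d + (2 * k + 1) - 1 - k - b)).factorial /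
        ((d + (2 * k + 1) - 1 - k - b).factorial *
          (d + (2 * k + 1) - k - b + (k - 1)).factorial) : ℚ) =
    2 ^ k * (∏ b ∈ Finset.range d, (b.factorial : ℚ)) * (k + d).factorial *
      ∏ t ∈ Finset.range k, ((2 * d + 2 * t + 1).factorial : ℚ) := by
  have h : ∏ b ∈ Finset.range k, ((2 * (d + (2 * k + 1) - 1 - k - b)).factorial /
        ((d + (2 * k + 1) - 1 - k - b).factorial *
          (d + (2 * k + 1) - k - b + (k - 1)).factorial) : ℚ) =
      ∏ t ∈ Finset.range k, ((2 * (d + t + 1)).factorial /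
        ((d + t + 1).factorial * (d + k + (t + 1)).factorial) : ℚ) := by
    rw [← Finset.prod_range_reflect]
    refine Finset.prod_congr rfl fun t ht => ?_
    rw [Finset.mem_range] at ht
    rw [show d + (2 * k + 1) - 1 - k - (k - 1 - t) = d + t + 1 by omega,
      show d + (2 * k + 1) - k - (k - 1 - t) + (k - 1) = d + k + (t + 1) by omega]
  rw [h, Finset.prod_range_add, show 2 * k + 1 = k + (k + 1) by ring, Finset.prod_range_add,
    Finset.prod_range_succ' (fun x => ((d + (k + x)).factorial : ℚ))]
  have key : (∏ t ∈ Finset.range k, ((d + t).factorial : ℚ)) *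
      (∏ t ∈ Finset.range k, ((d + (k + (t + 1))).factorial : ℚ)) *
      ∏ t ∈ Finset.range k, ((2 * (d + t + 1)).factorial /
        ((d + t + 1).factorial * (d + k + (t + 1)).factorial) : ℚ) =
      2 ^ k * ∏ t ∈ Finset.range k, ((2 * d + 2 * t + 1).factorial : ℚ) := by
    rw [← Finset.prod_mul_distrib, ← Finset.prod_mul_distrib, ← Finset.card_range k,
      ← Finset.prod_const, Finset.card_range, ← Finset.prod_mul_distrib]
    refine Finset.prod_congr rfl fun t _ => ?_
    rw [show 2 * (d + t + 1) = 2 * d + 2 * t + 1 + 1 by ring, Nat.factorial_succ (_ + 1),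
      Nat.factorial_succ (d + t), ← add_assoc d k (t + 1)]
    have h1 : ((d + t).factorial : ℚ) ≠ 0 := by positivity
    have h2 : ((d + k + (t + 1)).factorial : ℚ) ≠ 0 := by positivity
    push_cast
    field_simp
    ring
  rw [add_zero, add_comm k d]
  linear_combination (∏ b ∈ Finset.range d, (b.factorial : ℚ)) * (d + k).factorial * key

theorem prod_sub_eq_prod_add {M n c : ℕ} (h : M = c + n) (f : ℕ → ℚ) :
    ∏ j ∈ Finset.range n, f (M - j) = ∏ i ∈ Finset.range n, f (c + i + 1) := by
  rw [← Finset.prod_range_reflect]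
  refine Finset.prod_congr rfl fun i hi => ?_
  rw [Finset.mem_range] at hi
  congr 1
  omega

/-! ### Isolating the dependence on the width -/

/-- Here `c = m - r` is the gap below the last node and stays fixed as `d` varies, so all factors in
`c` and `k` alone go into `C`. -/
theorem exists_tableauSum_even (k c : ℕ) : ∃ C : ℚ, ∀ d : ℕ,
    tableauSum (2 * k) (d + 2 * k) (fun j => ((c + 2 * k + d - j : ℕ) : ℚ)) =
      C * rectangleFactor (c + 2 * k) d * E1Even (2 * k) (c + 2 * k) d *
        ∏ j ∈ Finset.range (d + 2 * k), ((c + 2 * k + d - j).factorial : ℚ) := by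
  obtain ⟨C, hC⟩ := exists_subsetSum_inv_eq k
  refine ⟨(-1) ^ k.choose 2 * C * (∏ b ∈ Finset.range k, ((2 * c + 2 * b + 1).factorial : ℚ)) *
    2 ^ k * (∏ i ∈ Finset.range (2 * k), ((c + i).factorial : ℚ))⁻¹, fun d => ?_⟩
  set u : ℚ := c + (d + 2 * k : ℕ) with hu
  have hx : ∀ j < d + 2 * k, ((c + 2 * k + d - j : ℕ) : ℚ) = u - j := fun j hj => by
    rw [hu, Nat.cast_sub (by omega)]
    push_cast
    ring
  rw [tableauSum_congr hx, tableauSum_even (by rw [hu]; simp), hC (d + 2 * k) c (by omega) u hu,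
    E1Even_eq_prod (by omega), rectangleFactor]
  have hX : ∏ j ∈ Finset.range (d + 2 * k), (u - j) =
      ∏ i ∈ Finset.range (d + 2 * k), ((c + i + 1 : ℕ) : ℚ) := by
    rw [← prod_sub_eq_prod_add (show c + 2 * k + d = c + (d + 2 * k) by ring) fun i => (i : ℚ)]
    exact Finset.prod_congr rfl fun j hj => (hx j (Finset.mem_range.1 hj)).symm
  have hF : ∏ j ∈ Finset.range (d + 2 * k), ((c + 2 * k + d - j).factorial : ℚ) =
      (∏ j ∈ Finset.range (d + 2 * k), (u - j)) *
        ((∏ i ∈ Finset.range (2 * k), ((c + i).factorial : ℚ)) *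
          ∏ j ∈ Finset.range d, ((c + 2 * k + j).factorial : ℚ)) := by
    rw [hX, prod_sub_eq_prod_add (show c + 2 * k + d = c + (d + 2 * k) by ring)
      fun i => (i.factorial : ℚ)]
    have : (∏ i ∈ Finset.range (2 * k), ((c + i).factorial : ℚ)) *
          ∏ j ∈ Finset.range d, ((c + 2 * k + j).factorial : ℚ) =
        ∏ i ∈ Finset.range (d + 2 * k), ((c + i).factorial : ℚ) := by
      rw [add_comm d, Finset.prod_range_add]
      simp only [add_assoc]
    rw [this, ← Finset.prod_mul_distrib]
    refine Finset.prod_congr rfl fun i _ => ?_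
    rw [Nat.factorial_succ]
    push_cast
    ring
  have hB : ∏ a ∈ Finset.range k, ((2 * c + 2 * (d + 2 * k) - 2 * a).factorial : ℚ)⁻¹ =
      ∏ t ∈ Finset.range k, ((2 * d + 2 * (c + 2 * k) - 2 * t).factorial : ℚ)⁻¹ := by
    rw [show 2 * c + 2 * (d + 2 * k) = 2 * d + 2 * (c + 2 * k) by ring]
  have hQ := prod_factorial_mul_even d k
  have hG : ∏ i ∈ Finset.range (2 * k), ((c + i).factorial : ℚ) ≠ 0 := by positivity
  have hM : ∏ j ∈ Finset.range d, ((c + 2 * k + j).factorial : ℚ) ≠ 0 := by positivity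
  rw [hB, hF]
  generalize ∏ i ∈ Finset.range (2 * k), ((c + i).factorial : ℚ) = G at hG ⊢
  generalize ∏ j ∈ Finset.range d, ((c + 2 * k + j).factorial : ℚ) = M at hM ⊢
  generalize ∏ j ∈ Finset.range (d + 2 * k), (u - j) = X
  generalize ∏ t ∈ Finset.range k, ((2 * d + 2 * (c + 2 * k) - 2 * t).factorial : ℚ)⁻¹ = B
  generalize ∏ b ∈ Finset.range k, ((2 * c + 2 * b + 1).factorial : ℚ) = A
  have h1 : G⁻¹ * G = 1 := inv_mul_cancel₀ hG
  have h2 : M⁻¹ * M = 1 := inv_mul_cancel₀ hM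
  generalize ∏ t ∈ Finset.range k, ((2 * d + 2 * t + 1).factorial : ℚ) = T at hQ ⊢
  generalize ∏ b ∈ Finset.range d, (b.factorial : ℚ) = D at hQ ⊢
  calc _ = (-1) ^ k.choose 2 * C * A * X * B * (2 ^ k * D * T) := by rw [← hQ]; ring
    _ = (-1) ^ k.choose 2 * C * A * X * B * (2 ^ k * D * T) * (G⁻¹ * G) * (M⁻¹ * M) := by
      rw [h1, h2]; ring
    _ = _ := by rw [div_eq_mul_inv]; ring

theorem exists_tableauSum_odd (k c : ℕ) : ∃ C : ℚ, ∀ d : ℕ,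
    tableauSum (2 * k + 1) (d + (2 * k + 1)) (fun j => ((c + (2 * k + 1) + d - j : ℕ) : ℚ)) =
      C * rectangleFactor (c + (2 * k + 1)) d *
        (((k + d).factorial : ℚ) / (c + (2 * k + 1) - k + d).factorial *
          E1Even (2 * k) (c + (2 * k + 1)) d) *
        ∏ j ∈ Finset.range (d + (2 * k + 1)), ((c + (2 * k + 1) + d - j).factorial : ℚ) := by
  obtain ⟨C, hC⟩ := exists_subsetSum_self_eq k
  refine ⟨(-1) ^ (k + 1).choose 2 * C *
    (∏ b ∈ Finset.range k, ((2 * c + 2 * b + 2).factorial : ℚ)) *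
    2 ^ k * 2 ^ k * (∏ i ∈ Finset.range (2 * k), ((c + i + 1).factorial : ℚ))⁻¹, fun d => ?_⟩
  set u : ℚ := c + (d + (2 * k + 1) : ℕ) with hu
  have hx : ∀ j < d + (2 * k + 1), ((c + (2 * k + 1) + d - j : ℕ) : ℚ) = u - j := fun j hj => by
    rw [hu, Nat.cast_sub (by omega)]
    push_cast
    ring
  rw [tableauSum_congr hx, tableauSum_odd (by rw [hu]; simp),
    hC (d + (2 * k + 1)) c (by omega) u hu, E1Even_eq_prod (by omega), rectangleFactor]
  have hF : ∏ j ∈ Finset.range (d + (2 * k + 1)), ((c + (2 * k + 1) + d - j).factorial : ℚ) =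
      (∏ i ∈ Finset.range (2 * k), ((c + i + 1).factorial : ℚ)) *
        ((∏ j ∈ Finset.range d, ((c + (2 * k + 1) + j).factorial : ℚ)) *
          (c + (2 * k + 1) + d).factorial) := by
    rw [prod_sub_eq_prod_add (show c + (2 * k + 1) + d = c + (d + (2 * k + 1)) by ring)
      fun i => (i.factorial : ℚ), show d + (2 * k + 1) = 2 * k + (d + 1) by ring,
      Finset.prod_range_add, Finset.prod_range_succ]
    congr 2
    · refine Finset.prod_congr rfl fun j _ => ?_
      congr 2
      ring
    · congr 2
      ring
  have hB : ∏ a ∈ Finset.range k, ((2 * c + 2 * (d + (2 * k + 1)) - 2 * a - 1).factorial : ℚ)⁻¹ =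
      2 ^ k * ((c + (2 * k + 1) + d).factorial / (c + (2 * k + 1) - k + d).factorial) *
      ∏ t ∈ Finset.range k, ((2 * d + 2 * (c + (2 * k + 1)) - 2 * t).factorial : ℚ)⁻¹ := by
    rw [show 2 * c + 2 * (d + (2 * k + 1)) = 2 * (c + (2 * k + 1) + d) by ring,
      show 2 * d + 2 * (c + (2 * k + 1)) = 2 * (c + (2 * k + 1) + d) by ring,
      show c + (2 * k + 1) - k + d = c + (2 * k + 1) + d - k by omega]
    exact prod_inv_factorial_eq _ _ (by omega)
  have hQ := prod_factorial_mul_odd d k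
  have hG : ∏ i ∈ Finset.range (2 * k), ((c + i + 1).factorial : ℚ) ≠ 0 := by positivity
  have hM : ∏ j ∈ Finset.range d, ((c + (2 * k + 1) + j).factorial : ℚ) ≠ 0 := by positivity
  rw [hB, hF]
  generalize ∏ i ∈ Finset.range (2 * k), ((c + i + 1).factorial : ℚ) = G at hG ⊢
  generalize ∏ j ∈ Finset.range d, ((c + (2 * k + 1) + j).factorial : ℚ) = M at hM ⊢
  generalize ∏ t ∈ Finset.range k, ((2 * d + 2 * (c + (2 * k + 1)) - 2 * t).factorial : ℚ)⁻¹ = B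
  generalize ∏ b ∈ Finset.range k, ((2 * c + 2 * b + 2).factorial : ℚ) = A
  have h1 : G⁻¹ * G = 1 := inv_mul_cancel₀ hG
  have h2 : M⁻¹ * M = 1 := inv_mul_cancel₀ hM
  generalize ∏ t ∈ Finset.range k, ((2 * d + 2 * t + 1).factorial : ℚ) = T at hQ ⊢
  generalize ∏ b ∈ Finset.range d, (b.factorial : ℚ) = D at hQ ⊢
  generalize ((c + (2 * k + 1) + d).factorial : ℚ) = U
  generalize ((c + (2 * k + 1) - k + d).factorial : ℚ) = W
  calc _ = (-1) ^ (k + 1).choose 2 * C * A * (2 ^ k * (U / W) * B) *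
        (2 ^ k * D * (k + d).factorial * T) := by rw [← hQ]; ring
    _ = (-1) ^ (k + 1).choose 2 * C * A * (2 ^ k * (U / W) * B) *
        (2 ^ k * D * (k + d).factorial * T) * (G⁻¹ * G) * (M⁻¹ * M) := by
      rw [h1, h2]; ring
    _ = _ := by rw [div_eq_mul_inv D M, div_eq_mul_inv U W, div_eq_mul_inv _ W]; ring

theorem exists_tableauSum_eq {m r : ℕ} (hr : r ≤ m) : ∃ C : ℚ, ∀ d : ℕ,
    tableauSum r (d + r) (fun j => ((m + d - j : ℕ) : ℚ)) =
      C * rectangleFactor m d * E1 r m d *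
        ∏ j ∈ Finset.range (d + r), ((m + d - j).factorial : ℚ) := by
  obtain ⟨c, rfl⟩ : ∃ c, m = c + r := ⟨m - r, by omega⟩
  rcases Nat.even_or_odd' r with ⟨k, rfl | rfl⟩
  · obtain ⟨C, hC⟩ := exists_tableauSum_even k c
    exact ⟨C, fun d => by rw [hC d, E1, if_pos (even_two_mul k)]⟩
  · obtain ⟨C, hC⟩ := exists_tableauSum_odd k c
    refine ⟨C, fun d => ?_⟩
    rw [hC d, E1, if_neg (by simp), Nat.add_sub_cancel, Nat.mul_div_cancel_left k two_pos]

/-- The number of tableaux of a truncated rectangle as a function of its width. -/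
theorem exists_numStandardTableaux_eq {m r : ℕ} (hr : r ≤ m) : ∃ C : ℚ, ∀ d : ℕ,
    (numStandardTableaux (columnDiagram d (d + r) fun j => m + d - j) : ℚ) =
      ((columnDiagram d (d + r) fun j => m + d - j).card.factorial : ℚ) *
        (C * rectangleFactor m d * E1 r m d) := by
  obtain ⟨C, hC⟩ := exists_tableauSum_eq hr
  refine ⟨C, fun d => ?_⟩
  have h := numStandardTableaux_columnDiagram (d := d) (r := r) rfl (x := fun j => m + d - j)
    (fun j hj => by omega) (fun j hj => by omega)
  rw [hC d, ← mul_assoc] at h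
  exact mul_right_cancel₀ (by positivity) h

/-! ### Sizes and identification of the three shapes -/

theorem two_mul_sum_range_sub {M n : ℕ} (hn : n ≤ M) :
    2 * ∑ j ∈ Finset.range n, (M - j) + n * (n - 1) = 2 * (n * M) := by
  induction n with
  | zero => simp
  | succ n ih =>
    have h1 := ih (by omega)
    rw [Finset.sum_range_succ]
    obtain ⟨e, rfl⟩ : ∃ e, M = n + e := ⟨M - n, by omega⟩
    rw [Nat.add_sub_cancel_left, Nat.add_sub_cancel]
    rcases n with _ | n
    · simp
    · rw [Nat.add_sub_cancel] at h1
      linarith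

theorem card_columnDiagram {m r : ℕ} (hr : r ≤ m) (d : ℕ) :
    (columnDiagram d (d + r) fun j => m + d - j).card + r.choose 2 = m * (d + r) := by
  have h1 := two_mul_card_columnDiagram (d := d) (r := r) rfl (x := fun j => m + d - j)
    (fun j hj => by omega)
  have h2 := two_mul_sum_range_sub (M := m + d) (n := d + r) (by omega)
  have h3 : 2 * r.choose 2 = r * (r - 1) := by
    rw [Nat.choose_two_right, Nat.mul_div_cancel' (Nat.even_mul_pred_self r).two_dvd]
  rcases r with _ | r
  · rcases d with _ | d
    · simp at h1 h3 ⊢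
      omega
    · simp only [add_zero, Nat.add_sub_cancel] at h1 h2 h3 ⊢
      nlinarith
  · rw [← add_assoc, Nat.add_sub_cancel] at h2
    rw [Nat.add_sub_cancel] at h3
    rw [← add_assoc] at h1 ⊢
    nlinarith

theorem mem_straightDiagram {lam mu : List ℕ} {p : ℕ × ℕ} :
    p ∈ straightDiagram lam mu ↔ p.1 < lam.length ∧ p.2 < lam.getD p.1 0 - mu.getD p.1 0 := by
  obtain ⟨i, j⟩ := p
  simp [straightDiagram]

theorem mem_shiftedDiagram {lam mu : List ℕ} {p : ℕ × ℕ} :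
    p ∈ shiftedDiagram lam mu ↔
      p.1 < lam.length ∧ p.1 ≤ p.2 ∧ p.2 < p.1 + (lam.getD p.1 0 - mu.getD p.1 0) := by
  obtain ⟨i, j⟩ := p
  simp only [shiftedDiagram, Finset.mem_biUnion, Finset.mem_range, Finset.mem_image,
    Prod.mk.injEq]
  constructor
  · rintro ⟨i', h1, j', h2, rfl, rfl⟩
    omega
  · rintro ⟨h1, h2, h3⟩
    exact ⟨i, h1, j - i, by omega, rfl, by omega⟩

theorem getD_descendingList {a r i : ℕ} (hi : i < r) : (descendingList a r).getD i 0 = a - i := by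
  simp [descendingList, hi]

theorem getD_staircase (k i : ℕ) : (staircase k).getD i 0 = k - i := by
  by_cases hi : i < k
  · exact getD_descendingList hi
  · rw [List.getD_eq_default _ _ (by simp [staircase, descendingList]; omega)]
    omega

/-- Row `i` loses `k - i` boxes of `n = d + k + 1`, which amounts to `j ≤ i + d`: column `j` starts
in row `j - d`. -/
theorem straightDiagram_staircase_eq {m n k d : ℕ} (hn : n = d + (k + 1)) :
    straightDiagram (List.replicate m n) (staircase k) =
      columnDiagram d (d + (k + 1)) fun j => m + d - j := by
  ext ⟨i, j⟩
  rw [mem_straightDiagram, mem_columnDiagram, getD_staircase, List.length_replicate]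
  dsimp only
  constructor
  · rintro ⟨h1, h2⟩
    rw [List.getD_replicate _ h1] at h2
    omega
  · rintro ⟨h1, h2, h3⟩
    have h4 : i < m := by omega
    rw [List.getD_replicate _ h4]
    omega

theorem straightDiagram_rectangle_eq (m d : ℕ) :
    straightDiagram (List.replicate m d) [] = columnDiagram d (d + 0) fun j => m + d - j := by
  ext ⟨i, j⟩
  rw [mem_straightDiagram, mem_columnDiagram, List.length_replicate]
  dsimp only
  constructor
  · rintro ⟨h1, h2⟩
    rw [List.getD_replicate _ h1] at h2
    simp at h2
    omega
  · rintro ⟨h1, h2, h3⟩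
    have h4 : i < m := by omega
    rw [List.getD_replicate _ h4]
    simp
    omega

theorem shiftedDiagram_eq_map (m r : ℕ) :
    shiftedDiagram (descendingList m r) [] =
      (columnDiagram 0 (0 + r) fun j => m + 0 - j).map (Equiv.prodComm ℕ ℕ).toEmbedding := by
  ext ⟨i, j⟩
  rw [mem_shiftedDiagram, Finset.mem_map_equiv, mem_columnDiagram]
  simp only [Equiv.prodComm_symm, Equiv.prodComm_apply, Prod.swap_prod_mk]
  have hlen : (descendingList m r).length = r := by simp [descendingList]
  rw [hlen]
  constructor
  · rintro ⟨h1, h2, h3⟩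
    rw [getD_descendingList h1] at h3
    simp at h3
    omega
  · rintro ⟨h1, h2, h3⟩
    rw [getD_descendingList (by omega)]
    simp
    omega

/-! ### The rectangle and the final comparison -/

/-- The hook length formula for rectangles. -/
theorem numStraightSYT_rectangle (m d : ℕ) :
    (numStraightSYT (List.replicate m d) : ℚ) = ((m * d).factorial : ℚ) * rectangleFactor m d := by
  obtain ⟨C, hC⟩ := exists_numStandardTableaux_eq (Nat.zero_le m)
  have hE : ∀ s, E1 0 m s = 1 := fun s => by simp [E1, E1Even]
  -- Width zero fixes the constant: the empty shape has one tableau.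
  have hC1 : C = 1 := by
    have h := hC 0
    have h0 : (columnDiagram 0 (0 + 0) fun j => m + 0 - j) = ∅ := rfl
    rw [h0, numStandardTableaux_empty, hE] at h
    simpa [rectangleFactor] using h.symm
  have hcard := card_columnDiagram (Nat.zero_le m) d
  rw [Nat.choose_zero_succ, add_zero] at hcard
  rw [numStraightSYT, straightDiagram_rectangle_eq, hC d, hC1, hE, hcard]
  simp

theorem theorem2 (n m k : ℕ) (hk : k < n) (hnm : n ≤ m) :
    (numStandardTableaux (straightDiagram (List.replicate m n) (staircase k)) : ℚ) =
      ((m * n - (k + 1).choose 2).choose (m * (n - k - 1)) : ℚ) *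
        (numStraightSYT (List.replicate m (n - k - 1)) : ℚ) *
        (numShiftedSYT (descendingList m (k + 1)) : ℚ) *
        (E1 (k + 1) m (n - k - 1) / E1 (k + 1) m 0) := by
  obtain ⟨d, hd⟩ : ∃ d, n = d + (k + 1) := ⟨n - (k + 1), by omega⟩
  have hr : k + 1 ≤ m := by omega
  -- The same `C` serves width `d` and width `0`; the latter counts the shifted shape and so
  -- eliminates `C`.
  obtain ⟨C, hC⟩ := exists_numStandardTableaux_eq hr
  have hcard := card_columnDiagram hr d
  have hcard0 := card_columnDiagram hr 0
  rw [straightDiagram_staircase_eq hd, numStraightSYT_rectangle, numShiftedSYT,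
    shiftedDiagram_eq_map, numStandardTableaux_map_swap, hC d, hC 0,
    show n - k - 1 = d by omega]
  set N := (columnDiagram d (d + (k + 1)) fun j => m + d - j).card with hN
  set M := (columnDiagram 0 (0 + (k + 1)) fun j => m + 0 - j).card with hM
  -- The boxes split into an `m × d` rectangle and the shifted part, so the binomial coefficient is
  -- `N! / ((m * d)! * M!)`.
  have hNM : N = m * d + M := by
    have : m * (d + (k + 1)) = m * d + m * (0 + (k + 1)) := by ring
    omega
  have hsub : m * n - (k + 1).choose 2 = N := by
    rw [hd]
    omega
  rw [hsub, Nat.cast_choose ℚ (show m * d ≤ N by omega), show N - m * d = M by omega]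
  have h0 : rectangleFactor m 0 = 1 := by simp [rectangleFactor]
  rw [h0]
  have h1 : ((m * d).factorial : ℚ) ≠ 0 := by positivity
  have h2 : (M.factorial : ℚ) ≠ 0 := by positivity
  have h3 : E1 (k + 1) m 0 ≠ 0 := E1_ne_zero hr
  field_simp
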